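/- Let $n,m\ge 0$, $T\ge 1$ and $x_{\rm init}\in\mathbb R^n$. A curve is $\xi=(\alpha_0,\dots,\alpha_T,\mu_0,\dots,\mu_{T-1})\in\mathbb R^{n(T+1)+mT}$ (Euclidean norm). A curve $\eta=(x_0,\dots,x_T,u_0,\dots,u_{T-1})$ is a trajectory, $\eta\in\mathcal T$, if $x_0=x_{\rm init}$ and $x_{t+1}=f(x_t,u_t)$ for $0\le t<T$. Let $\ell(\xi)=\sum_{t<T}\ell_t(\alpha_t,\mu_t)+\ell_T(\alpha_T)$ be the cost. Assume: 1. $f:\mathbb R^n\times\mathbb R^m\to\mathbb R^n$ and $\ell$ are $C^2$; 2. $\nabla^2\ell(\xi)$ is positive definite for every curve $\xi$; 3. the tracking controller $\pi(\alpha,\mu,x,t)\in\mathbb R^m$ is $C^2$ in $(\alpha,\mu,x)$ for each $t\in\mathbb N$, and $\pi(\alpha,\mu,\alpha,t)=\mu$ for all $\alpha,\mu,t$. Let $\eta^\star\in\mathcal T$ be an isolated local minimum of $\ell$ on $\mathcal T$: for some $r>0$, every $\eta\in\mathcal T$ with $\|\eta-\eta^\star\|<r$ satisfies $\ell(\eta)\ge\ell(\eta^\star)$,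 and no such $\eta\neq\eta^\star$ is stationary, where $\eta\in\mathcal T$ is called stationary if $D\ell(\eta)\zeta=0$ for all $\zeta=(\Delta x,\Delta u)$ with $\Delta x_0=0$ and $\Delta x_{t+1}=Df(x_t,u_t)(\Delta x_t,\Delta u_t)$. (This is the case if the second-order sufficient optimality condition holds at $\eta^\star$.) Given a trajectory $\eta=(x,u)$ and dithers $d^i_{x,t}\in\mathbb R^n$, $d^i_{u,t}\in\mathbb R^m$ ($1\le i\le L$, $0\le t<T$), the experiments are $$\hat x^i_0=x_{\rm init}+d^i_{x,0},\qquad \hat u^i_t=\pi(x_t+d^i_{x,t},\,u_t+d^i_{u,t},\,\hat x^i_t,\,t),\qquad \hat x^i_{t+1}=f(\hat x^i_t,\hat u^i_t).$$ Let $\Delta X_t,\Delta U_t,\Delta X_t^+$ be the matrices with columns $\hat x^i_t-x_t$, $\hat u^i_t-u_t$, $\hat x^i_{t+1}-x_{t+1}$, and let $D_t=\begin{bmatrix}\Delta X_t\\ \Delta U_t\end{bmatrix}$. For $M>0$, call the dithers admissible at $\eta$ for $(\delta_x,\delta_u)$ if $L\ge n+m$, $\|d^i_{x,t}\|\le\delta_x$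 and $\|d^i_{u,t}\|\le\delta_u$ for all $i,t$, and the spectral condition number of $D_tD_t^\top$ is at most $M$ for all $t<T$. Assume moreover: 4. for some $M>0$ and $c>0$, admissible dithers exist for all $\delta_x,\delta_u>0$ and all trajectories $\eta$ with $\|\eta-\eta^\star\|<c$. DATA-DRIVEN PRONTO with stepsize $\gamma$ and dither amplitudes $\delta_x,\delta_u$ starts from a trajectory $\eta^0$. At iteration $k$, with $\eta^k=(x,u)$, it chooses any dithers that are admissible at $\eta^k$ and sets $[\hat A_t\ \hat B_t]=\Delta X_t^+D_t^\dagger$ (Moore–Penrose pseudoinverse). It computes the minimizer $(\Delta\hat x,\Delta\hat u)$ of the quadratic form $$\tfrac12\zeta^\top\nabla^2\ell(\eta^k)\zeta+\nabla\ell(\eta^k)^\top\zeta,\qquad \zeta=(\Delta x,\Delta u),$$ subject to $\Delta x_0=0$, $\Delta x_{t+1}=\hat A_t\Delta x_t+\hat B_t\Delta u_t$. It puts $\alpha_t=x_t+\gamma\Delta\hat x_t$, $\mu_t=u_t+\gamma\Delta\hat u_t$ for $t<T$. Finally $\eta^{k+1}=(x^+,u^+)$ is given by $x^+_0=x_{\rm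 init}$, $u^+_t=\pi(\alpha_t,\mu_t,x^+_t,t)$, $x^+_{t+1}=f(x^+_t,u^+_t)$. **Theorem.** There exist $\gamma^\star>0$, $\bar\delta_x,\bar\delta_u>0$ and $\rho>0$ such that both of the following hold. (i) There exist $N\in\mathbb N$ and a function $b:[0,\infty)^2\to\mathbb R$, strictly increasing in each argument and with $b(0,0)=0$, such that for all $\delta_x\in(0,\bar\delta_x)$, $\delta_u\in(0,\bar\delta_u)$, $\gamma\in(0,\gamma^\star]$, every run of the algorithm with $\|\eta^0-\eta^\star\|<\rho$ satisfies $$\|\eta^k-\eta^\star\|\le b(\delta_x,\delta_u)\qquad\text{for all }k\ge N.$$ (ii) There exists a *continuous* function $b:[0,\infty)^2\to\mathbb R$, strictly increasing in each argument and with $b(0,0)=0$, such that for all $\delta_x\in(0,\bar\delta_x)$, $\delta_u\in(0,\bar\delta_u)$, $\gamma\in(0,\gamma^\star]$ there is $N\in\mathbb N$ such that every run of the algorithm with $\|\eta^0-\eta^\star\|<\rho$ satisfies $\|\eta^k-\eta^\star\|\le b(\delta_x,\delta_u)$ for all $k\ge N$. -/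

import Mathlib

open scoped ENNReal

noncomputable section

namespace DataDrivenPronto

/-- `ℝᵈ` with its Euclidean norm. -/
abbrev E (d : ℕ) : Type := EuclideanSpace ℝ (Fin d)

/-- State-input curves `(α₀, …, α_T, μ₀, …, μ_{T-1})` with the Euclidean norm of `ℝ^{n(T+1)+mT}`. -/
abbrev Curve (n m T : ℕ) : Type :=
  WithLp 2 (PiLp 2 (fun _ : Fin (T + 1) => E n) × PiLp 2 (fun _ : Fin T => E m))

/-- State at time `t = 0, …, T` of a curve. -/
def Curve.x {n m T : ℕ} (η : Curve n m T) (t : Fin (T + 1)) : E n := η.fst t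

/-- Input at time `t = 0, …, T - 1` of a curve. -/
def Curve.u {n m T : ℕ} (η : Curve n m T) (t : Fin T) : E m := η.snd t

/-- The state-input pair `(x_t, u_t)` of a curve. -/
def Curve.xu {n m T : ℕ} (η : Curve n m T) (t : Fin T) : E n × E m :=
  (Curve.x η t.castSucc, Curve.u η t)

/-- The data of a finite-horizon optimal control problem: dynamics `x_{t+1} = f (x_t, u_t)`,
initial state, stage costs and terminal cost. -/
structure OptimalControlProblem (n m T : ℕ) where
  f : E n × E m → E n
  xInit : E n
  stageCost : Fin T → E n × E m → ℝ
  terminalCost : E n → ℝ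

namespace OptimalControlProblem

variable {n m T : ℕ} (P : OptimalControlProblem n m T)

/-- Total cost of a curve. -/
def cost (η : Curve n m T) : ℝ :=
  ∑ t, P.stageCost t (Curve.xu η t) + P.terminalCost (Curve.x η (Fin.last T))

/-- Membership in the trajectory manifold. -/
def IsTrajectory (η : Curve n m T) : Prop :=
  Curve.x η 0 = P.xInit ∧ ∀ t : Fin T, Curve.x η t.succ = P.f (Curve.xu η t)

/-- Membership of `ζ` in the tangent space of the trajectory manifold at `η`: trajectories
of the linearized dynamics that start at `0`. -/
def IsTangent (η ζ : Curve n m T) : Prop :=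
  Curve.x ζ 0 = 0 ∧
    ∀ t : Fin T, Curve.x ζ t.succ = fderiv ℝ P.f (Curve.xu η t) (Curve.xu ζ t)

/-- First-order stationary trajectories of the optimal control problem. -/
def IsStationary (η : Curve n m T) : Prop :=
  P.IsTrajectory η ∧ ∀ ζ, P.IsTangent η ζ → fderiv ℝ P.cost η ζ = 0

/-- A trajectory that minimizes the cost among the trajectories near it, and near which there is
no other stationary trajectory (so, in particular, no other local minimum). -/
def IsIsolatedLocalMin (ηs : Curve n m T) : Prop :=
  P.IsTrajectory ηs ∧ ∃ r > 0, ∀ η ∈ Metric.ball ηs r, P.IsTrajectory η →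
    P.cost ηs ≤ P.cost η ∧ (P.IsStationary η → η = ηs)

/-- `η` is the closed-loop response from the initial state `x₀` of the dynamics under the
tracking controller `π`, with reference `(α, μ)`. -/
def IsClosedLoop (π : E n → E m → E n → ℕ → E m) (x₀ : E n) (α : Fin T → E n) (μ : Fin T → E m)
    (η : Curve n m T) : Prop :=
  Curve.x η 0 = x₀ ∧ ∀ t : Fin T,
    Curve.u η t = π (α t) (μ t) (Curve.x η t.castSucc) t ∧
    Curve.x η t.succ = P.f (Curve.xu η t)

/-- The `L` experiments `ηh i` obtained in closed loop from the current trajectory `η` with the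
dithers `dx`, `du`. -/
def IsExperiment [NeZero T] (π : E n → E m → E n → ℕ → E m) (η : Curve n m T) {L : ℕ}
    (dx : Fin L → Fin T → E n) (du : Fin L → Fin T → E m) (ηh : Fin L → Curve n m T) : Prop :=
  ∀ i, P.IsClosedLoop π (P.xInit + dx i 0) (fun t => Curve.x η t.castSucc + dx i t)
    (fun t => Curve.u η t + du i t) (ηh i)

end OptimalControlProblem

variable {n m T : ℕ}

/-- The data batch obtained by stacking `ΔX_t` on top of `ΔU_t`. -/
def batch (η : Curve n m T) {L : ℕ} (ηh : Fin L → Curve n m T) (t : Fin T) :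
    Matrix (Fin n ⊕ Fin m) (Fin L) ℝ :=
  Matrix.fromRows
    (Matrix.of fun a i => Curve.x (ηh i) t.castSucc a - Curve.x η t.castSucc a)
    (Matrix.of fun a i => Curve.u (ηh i) t a - Curve.u η t a)

/-- The data batch `ΔX⁺_t`. -/
def batchNext (η : Curve n m T) {L : ℕ} (ηh : Fin L → Curve n m T) (t : Fin T) :
    Matrix (Fin n) (Fin L) ℝ :=
  Matrix.of fun a i => Curve.x (ηh i) t.succ a - Curve.x η t.succ a

open Classical in
/-- Spectral condition number `‖A‖ ‖A⁻¹‖` of a square matrix, infinite if `A` is singular. -/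
def conditionNumber {ι : Type*} [Fintype ι] [DecidableEq ι] (A : Matrix ι ι ℝ) : ℝ≥0∞ :=
  if IsUnit A.det then
    ENNReal.ofReal (‖Matrix.toEuclideanCLM (𝕜 := ℝ) A‖ * ‖Matrix.toEuclideanCLM (𝕜 := ℝ) A⁻¹‖)
  else ⊤

/-- `B` is the Moore–Penrose pseudoinverse of `A` (the four Penrose equations). -/
def IsPseudoinverse {ι κ : Type*} [Fintype ι] [Fintype κ] (A : Matrix ι κ ℝ) (B : Matrix κ ι ℝ) :
    Prop :=
  A * B * A = A ∧ B * A * B = B ∧ (A * B).transpose = A * B ∧ (B * A).transpose = B * A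

namespace OptimalControlProblem

variable (P : OptimalControlProblem n m T)

/-- The dithers are bounded by `δx`, `δu`, and the experiments `ηh` that they produce around
`η` have batches whose Gram matrices have condition number at most `M`. -/
def IsAdmissible [NeZero T] (π : E n → E m → E n → ℕ → E m) (M δx δu : ℝ) (η : Curve n m T) {L : ℕ}
    (dx : Fin L → Fin T → E n) (du : Fin L → Fin T → E m) (ηh : Fin L → Curve n m T) : Prop :=
  (∀ i t, ‖dx i t‖ ≤ δx ∧ ‖du i t‖ ≤ δu) ∧ P.IsExperiment π η dx du ηh ∧
  ∀ t, conditionNumber (batch η ηh t * (batch η ηh t).transpose) ≤ ENNReal.ofReal M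

/-- Well-posed identification near `ηs`, with condition number bound `M`. -/
def WellPosed [NeZero T] (π : E n → E m → E n → ℕ → E m) (M : ℝ) (ηs : Curve n m T) : Prop :=
  ∃ c > 0, ∀ δx > 0, ∀ δu > 0, ∀ η ∈ Metric.ball ηs c, P.IsTrajectory η →
    ∃ L : ℕ, n + m ≤ L ∧ ∃ (dx : Fin L → Fin T → E n) (du : Fin L → Fin T → E m)
      (ηh : Fin L → Curve n m T), P.IsAdmissible π M δx δu η dx du ηh

/-- Objective of the linear-quadratic descent problem at `η`: the blocks `Q_t, S_t, R_t` and
`q_t, r_t` are those of the second and first derivative of the stage cost at `(x_t, u_t)`. -/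
def lqrCost (η ζ : Curve n m T) : ℝ :=
  ∑ t, ((1 / 2) * fderiv ℝ (fderiv ℝ (P.stageCost t)) (Curve.xu η t) (Curve.xu ζ t) (Curve.xu ζ t)
      + fderiv ℝ (P.stageCost t) (Curve.xu η t) (Curve.xu ζ t))
    + ((1 / 2) * fderiv ℝ (fderiv ℝ P.terminalCost) (Curve.x η (Fin.last T))
          (Curve.x ζ (Fin.last T)) (Curve.x ζ (Fin.last T))
      + fderiv ℝ P.terminalCost (Curve.x η (Fin.last T)) (Curve.x ζ (Fin.last T)))

/-- Solutions of the linear dynamics `Δx_{t+1} = A_t Δx_t + B_t Δu_t`, `Δx₀ = 0`, where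
`G t = [A_t B_t]`. -/
def lqrFeasible (G : Fin T → Matrix (Fin n) (Fin n ⊕ Fin m) ℝ) : Set (Curve n m T) :=
  {ζ | Curve.x ζ 0 = 0 ∧ ∀ (t : Fin T) (a : Fin n),
    Curve.x ζ t.succ a =
      (G t).mulVec (Sum.elim (fun j => Curve.x ζ t.castSucc j) (fun j => Curve.u ζ t j)) a}

/-- One iteration `η ↦ η'` of data-driven PRONTO with stepsize `γ`: closed-loop experiments with
dithers admissible for `M`, `δx`, `δu`; least-squares estimate `G t = [Â_t B̂_t]` of the
linearizations; descent direction `ζ` from the estimated linear-quadratic problem; update of the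
curve and closed-loop projection onto the trajectory manifold. -/
def IsStep [NeZero T] (π : E n → E m → E n → ℕ → E m) (M δx δu γ : ℝ) (η η' : Curve n m T) : Prop :=
  ∃ L : ℕ, n + m ≤ L ∧ ∃ (dx : Fin L → Fin T → E n) (du : Fin L → Fin T → E m)
    (ηh : Fin L → Curve n m T) (G : Fin T → Matrix (Fin n) (Fin n ⊕ Fin m) ℝ) (ζ : Curve n m T),
    P.IsAdmissible π M δx δu η dx du ηh ∧
    (∀ t, ∃ D, IsPseudoinverse (batch η ηh t) D ∧ G t = batchNext η ηh t * D) ∧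
    ζ ∈ lqrFeasible G ∧ IsMinOn (P.lqrCost η) (lqrFeasible G) ζ ∧
    P.IsClosedLoop π P.xInit (fun t => Curve.x η t.castSucc + γ • Curve.x ζ t.castSucc)
      (fun t => Curve.u η t + γ • Curve.u ζ t) η'

/-- `η 0, η 1, …` are the iterates of a run of data-driven PRONTO started on the trajectory
`η 0`. -/
def IsRun [NeZero T] (π : E n → E m → E n → ℕ → E m) (M δx δu γ : ℝ) (η : ℕ → Curve n m T) : Prop :=
  P.IsTrajectory (η 0) ∧ ∀ k, P.IsStep π M δx δu γ (η k) (η (k + 1))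

end OptimalControlProblem

/-- A function of the two dither amplitudes that is strictly increasing in each of them on
`[0, ∞)` and zero at zero. -/
def IsUltimateBound (b : ℝ → ℝ → ℝ) : Prop :=
  b 0 0 = 0 ∧ (∀ δu, 0 ≤ δu → StrictMonoOn (fun δx => b δx δu) (Set.Ici 0)) ∧
    ∀ δx, 0 ≤ δx → StrictMonoOn (fun δu => b δx δu) (Set.Ici 0)

end DataDrivenPronto

end

/-! The proof is a Lyapunov argument with `V η = ℓ(η) - ℓ(η⋆)`, decreasing at a rate `W η`
proportional to `‖DJ‖²`, where `J` (`reducedCost`) is the cost as a function of the input alone. A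
trajectory is stationary exactly when its input is critical for `J`, so isolation makes both `V` and
`W` positive on the other trajectories near `η⋆` (`IsIsolatedLocalMin.exists_pos`).

The core is `exists_descent`: one step gives `V(η⁺) ≤ V(η) - γ W(η) + γ C (δx + δu)²`. The
experiments deviate from `η` by `O(δ)`, so the linearization explains the data up to a relative
residual `O(δ)`. Least squares turns this into an `O(δ)` error in `[Â B̂]`, because the condition
number of the Gram matrix is scale invariant (`leastSquares_error`, `exists_identification_error`).
Responses of the identified and the true linearization to one input therefore differ by a relative
`O(δ)`. Combined with the Euler equation of the quadratic problem and the coercivity of the Hessian,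
this makes `ζ` a descent direction for `ℓ` composed with the projection, and makes `‖ζ‖ + O(δ)`
dominate `‖DJ‖`. Young's inequality makes the total error quadratic in `δ`.

`practical_stability` then keeps runs in a fixed ball and, for small `δ`, brings them into any
smaller one, after a number of steps that depends on `γ`. In (i) the bound may be discontinuous, so
the fixed ball suffices, with `N = 0`. In (ii) `exists_comparison_function` interpolates the radii
by a continuous function of `δx + δu`. -/

noncomputable section

namespace DataDrivenPronto

open Metric Set

/-! ### Uniform Taylor and coercivity estimates on balls. -/

section Analysis

variable {X Y : Type*} [NormedAddCommGroup X] [NormedSpace ℝ X] [NormedAddCommGroup Y]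
  [NormedSpace ℝ Y]

theorem exists_norm_le_closedBall {X Y : Type*} [SeminormedAddCommGroup X]
    [SeminormedAddCommGroup Y] [ProperSpace X] {g : X → Y} (hg : Continuous g) (x₀ : X)
    (r : ℝ) : ∃ C > 0, ∀ x ∈ closedBall x₀ r, ‖g x‖ ≤ C := by
  obtain ⟨C, hC⟩ := (isCompact_closedBall x₀ r).exists_bound_of_continuousOn hg.continuousOn
  exact ⟨max C 1, by positivity, fun x hx => (hC x hx).trans (le_max_left _ _)⟩

theorem add_mem_closedBall_add_one {X : Type*} [SeminormedAddCommGroup X] {x₀ x h : X} {r : ℝ} (hx : x ∈ closedBall x₀ r)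
    (hh : ‖h‖ ≤ 1) : x + h ∈ closedBall x₀ (r + 1) := by
  rw [mem_closedBall, dist_eq_norm] at *
  calc ‖x + h - x₀‖ = ‖(x - x₀) + h‖ := by congr 1; abel
    _ ≤ _ := (norm_add_le _ _).trans (add_le_add hx hh)

theorem exists_norm_sub_le [ProperSpace X] {g : X → Y} (hg : ContDiff ℝ 1 g) (x₀ : X) (r : ℝ) :
    ∃ C > 0, ∀ x ∈ closedBall x₀ r, ∀ h : X, ‖h‖ ≤ 1 → ‖g (x + h) - g x‖ ≤ C * ‖h‖ := by
  obtain ⟨C, hC0, hC⟩ := exists_norm_le_closedBall (hg.continuous_fderiv one_ne_zero) x₀ (r + 1)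
  refine ⟨C, hC0, fun x hx h hh => ?_⟩
  have := (convex_closedBall x₀ (r + 1)).norm_image_sub_le_of_norm_fderiv_le
    (fun y _ => (hg.differentiable one_ne_zero) y) hC
    (closedBall_subset_closedBall (by linarith) hx) (add_mem_closedBall_add_one hx hh)
  simpa using this

/-- On the ball of radius `‖h‖` about `x`, the derivative of `g` differs from its value at `x` by at
most `C ‖h‖`; the mean value inequality supplies the second factor `‖h‖`. -/
theorem exists_norm_sub_sub_fderiv_le [ProperSpace X] {g : X → Y} (hg : ContDiff ℝ 2 g) (x₀ : X)
    (r : ℝ) :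
    ∃ C > 0, ∀ x ∈ closedBall x₀ r, ∀ h : X, ‖h‖ ≤ 1 →
      ‖g (x + h) - g x - fderiv ℝ g x h‖ ≤ C * ‖h‖ ^ 2 := by
  obtain ⟨C, hC0, hC⟩ := exists_norm_sub_le (hg.fderiv_right (m := 1) (by norm_num)) x₀ r
  refine ⟨C, hC0, fun x hx h hh => ?_⟩
  have := (convex_closedBall x ‖h‖).norm_image_sub_le_of_norm_fderiv_le'
    (f := g) (φ := fderiv ℝ g x) (C := C * ‖h‖) (x := x) (y := x + h)
    (fun y _ => (hg.differentiable two_ne_zero) y) (fun y hy => ?_) (by simp) (by simp)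
  · rw [add_sub_cancel_left] at this
    linarith [this, sq ‖h‖, mul_assoc C ‖h‖ ‖h‖]
  · rw [mem_closedBall, dist_eq_norm] at hy
    have h2 := hC x hx (y - x) (hy.trans hh)
    rw [add_sub_cancel] at h2
    exact h2.trans (mul_le_mul_of_nonneg_left hy hC0.le)

/-- Compactness of ball times unit sphere gives a positive minimum, and homogeneity extends it to
all `ζ`. -/
theorem exists_mul_sq_norm_le [FiniteDimensional ℝ X] {B : X → X →L[ℝ] X →L[ℝ] ℝ}
    (hB : Continuous B) (hpos : ∀ ξ ζ : X, ζ ≠ 0 → 0 < B ξ ζ ζ) (x₀ : X) (r : ℝ) :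
    ∃ c > 0, ∀ ξ ∈ closedBall x₀ r, ∀ ζ, c * ‖ζ‖ ^ 2 ≤ B ξ ζ ζ := by
  have : ProperSpace X := FiniteDimensional.proper ℝ X
  obtain ⟨c, hc, h⟩ := ((isCompact_closedBall x₀ r).prod
    (isCompact_sphere (0 : X) 1)).exists_forall_le' (f := fun p : X × X => B p.1 p.2 p.2) (a := 0)
    (by fun_prop) (fun p hp => hpos _ _ (fun h => by simp [h] at hp))
  refine ⟨c, hc, fun ξ hξ ζ => ?_⟩
  rcases eq_or_ne ζ 0 with rfl | hζ
  · simp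
  have hn : 0 < ‖ζ‖ := norm_pos_iff.2 hζ
  have := h (ξ, ‖ζ‖⁻¹ • ζ) ⟨hξ, by simp [norm_smul, hn.ne']⟩
  simp only [map_smul, smul_apply, smul_eq_mul] at this
  calc c * ‖ζ‖ ^ 2 ≤ (‖ζ‖⁻¹ * (‖ζ‖⁻¹ * B ξ ζ ζ)) * ‖ζ‖ ^ 2 := by gcongr
    _ = _ := by field_simp

/-- A quadratic form that is minimal over a subspace at `ζ` satisfies the Euler equation there. -/
theorem eq_zero_of_forall_quadratic_le {B : X →L[ℝ] X →L[ℝ] ℝ} {ℓ : X →L[ℝ] ℝ}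
    (hB : ∀ v w, B v w = B w v) {ζ w : X}
    (h : ∀ s : ℝ, 1 / 2 * B ζ ζ + ℓ ζ ≤
      1 / 2 * B (ζ + s • w) (ζ + s • w) + ℓ (ζ + s • w)) : B ζ w + ℓ w = 0 := by
  have h' : ∀ s : ℝ, 0 ≤ s * (B ζ w + ℓ w) + s ^ 2 * (1 / 2 * B w w) := by
    intro s
    have := h s
    simp only [map_add, map_smul, add_apply, smul_apply,
      smul_eq_mul, hB w ζ] at this
    linarith
  have hmin : IsLocalMin (fun s : ℝ => s * (B ζ w + ℓ w) + s ^ 2 * (1 / 2 * B w w)) 0 :=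
    Filter.Eventually.of_forall fun s => by simpa using h' s
  have hd : HasDerivAt (fun s : ℝ => s * (B ζ w + ℓ w) + s ^ 2 * (1 / 2 * B w w))
      (1 * (B ζ w + ℓ w) + (((2 : ℕ) : ℝ) * 0 ^ (2 - 1)) * (1 / 2 * B w w)) 0 :=
    ((hasDerivAt_id' (0 : ℝ)).mul_const _).add ((hasDerivAt_pow 2 (0 : ℝ)).mul_const _)
  have := hmin.hasDerivAt_eq_zero hd
  simpa using this

end Analysis

/-! ### Practical stability and the comparison function. -/

section Stability

/-- Here `D k` is the amplitude below which the radius `R / 2 ^ (k + 1)` is guaranteed. A uniformly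
convergent sum of ramps works: the `k`-th ramp has height `R / 2 ^ k` and is saturated once `δ`
exceeds `D k`. -/
theorem exists_comparison_function {R : ℝ} (hR : 0 ≤ R) {D : ℕ → ℝ} (hD : ∀ k, 0 < D k) :
    ∃ β : ℝ → ℝ, Continuous β ∧ MonotoneOn β (Ici 0) ∧ β 0 = 0 ∧
      ∀ δ > 0, R ≤ β δ ∨ ∃ k, δ ≤ D k ∧ R * (1 / 2) ^ (k + 1) ≤ β δ := by
  -- The cap `(1 / 2) ^ k` forces the thresholds to tend to `0`, so that every `δ > 0` saturates
  -- some ramp.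
  set D' : ℕ → ℝ := fun k => min (D k) ((1 / 2) ^ k) with hD'
  have hpos : ∀ k, 0 < D' k := fun k => lt_min (hD k) (by positivity)
  set F : ℕ → ℝ → ℝ := fun k δ => R * (1 / 2) ^ k * min 1 (|δ| / D' k) with hF
  have hF0 : ∀ k δ, 0 ≤ F k δ := fun k δ => by
    have := hpos k
    simp only [hF]; positivity
  have hFle : ∀ k δ, F k δ ≤ R * (1 / 2) ^ k := fun k δ =>
    mul_le_of_le_one_right (by positivity) (min_le_left _ _)
  have hs : Summable fun k : ℕ => R * (1 / 2 : ℝ) ^ k :=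
    (summable_geometric_of_lt_one (by norm_num) (by norm_num)).mul_left R
  have hsF : ∀ δ, Summable fun k => F k δ := fun δ =>
    Summable.of_nonneg_of_le (fun k => hF0 k δ) (fun k => hFle k δ) hs
  refine ⟨fun δ => ∑' k, F k δ, ?_, ?_, by simp [hF], ?_⟩
  · refine continuous_tsum (fun k => ?_) hs fun k δ => ?_
    · simp only [hF]; fun_prop
    · rw [Real.norm_of_nonneg (hF0 k δ)]; exact hFle k δ
  · intro a ha b hb hab
    refine (hsF a).tsum_le_tsum (fun k => ?_) (hsF b)
    have := hpos k
    simp only [hF, abs_of_nonneg (mem_Ici.1 ha), abs_of_nonneg (mem_Ici.1 hb)]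
    gcongr
  · intro δ hδ
    have hex : ∃ k, D' k < δ := by
      obtain ⟨k, hk⟩ := exists_pow_lt_of_lt_one hδ (by norm_num : (1 / 2 : ℝ) < 1)
      exact ⟨k, (min_le_right _ _).trans_lt hk⟩
    classical
    -- At the first saturated index `k`, minimality gives `δ ≤ D (k - 1)`, while the `k`-th ramp
    -- alone contributes `R / 2 ^ k`; this explains the exponent `k + 1` in the statement.
    obtain ⟨k, hk, hmin⟩ : ∃ k, D' k < δ ∧ ∀ j < k, ¬ D' j < δ :=
      ⟨Nat.find hex, Nat.find_spec hex, fun j hj => Nat.find_min hex hj⟩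
    have hle : R * (1 / 2) ^ k ≤ ∑' k, F k δ := by
      have h1 : F k δ = R * (1 / 2) ^ k := by
        have : 1 ≤ |δ| / D' k := by
          rw [one_le_div (hpos k), abs_of_pos hδ]; exact hk.le
        simp only [hF, min_eq_left this, mul_one]
      rw [← h1]
      exact (hsF δ).le_tsum k fun j _ => hF0 j δ
    cases k with
    | zero => left; simpa using hle
    | succ k => exact .inr ⟨k, (not_lt.1 (hmin k k.lt_succ_self)).trans (min_le_left _ _), hle⟩

/-- Practical stability from a Lyapunov function `V` that decreases at the rate `W`, up to a
perturbation of size `C δ²`, along the steps of a relation on a closed set `S`. -/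
theorem practical_stability {X : Type*} [NormedAddCommGroup X] [ProperSpace X] {S : Set X}
    (hS : IsClosed S) {z : X} {V W : X → ℝ} (hV : Continuous V) (hW : Continuous W)
    (hVz : V z = 0) (hW0 : ∀ η, 0 ≤ W η) {r : ℝ} (hr : 0 < r)
    (hpos : ∀ η ∈ S, η ∈ closedBall z r → η ≠ z → 0 < V η ∧ 0 < W η)
    {Step : ℝ → ℝ → ℝ → X → X → Prop} {C γ₁ δ₁ : ℝ} (hC : 0 < C) (hγ₁ : 0 < γ₁) (hδ₁ : 0 < δ₁)
    (hstep : ∀ δx > 0, ∀ δu > 0, δx + δu ≤ δ₁ → ∀ γ ∈ Ioc 0 γ₁, ∀ η ∈ S, η ∈ closedBall z r →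
      ∀ η', Step δx δu γ η η' → η' ∈ S ∧ ‖η' - η‖ ≤ C * γ ∧
        V η' ≤ V η - γ * W η + γ * (C * (δx + δu) ^ 2)) :
    ∃ γs > 0, ∃ δb > 0, ∃ ρ > 0,
      (∀ δx > 0, ∀ δu > 0, δx + δu ≤ δb → ∀ γ ∈ Ioc 0 γs, ∀ η : ℕ → X, η 0 ∈ S →
        (∀ k, Step δx δu γ (η k) (η (k + 1))) → η 0 ∈ ball z ρ → ∀ k, ‖η k - z‖ ≤ r) ∧
      ∀ ε > 0, ∃ δ₀ > 0, ∀ δx > 0, ∀ δu > 0, δx + δu ≤ δb → δx + δu ≤ δ₀ → ∀ γ ∈ Ioc 0 γs,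
        ∃ N : ℕ, ∀ η : ℕ → X, η 0 ∈ S → (∀ k, Step δx δu γ (η k) (η (k + 1))) →
          η 0 ∈ ball z ρ → ∀ k ≥ N, ‖η k - z‖ ≤ ε := by
  have hV0 : ∀ η ∈ S, η ∈ closedBall z r → 0 ≤ V η := fun η hη hηr => by
    rcases eq_or_ne η z with rfl | hne
    · exact hVz.ge
    · exact (hpos η hη hηr hne).1.le
  have hKc : IsCompact (S ∩ closedBall z r) := (isCompact_closedBall z r).inter_left hS
  -- positive lower bounds away from `z`
  have hlow : ∀ ε > 0, ∃ v > 0, ∃ w > 0, ∀ η ∈ S, η ∈ closedBall z r →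
      (V η < v → ‖η - z‖ < ε) ∧ (v / 2 ≤ V η → w ≤ W η) := by
    intro ε hε
    obtain ⟨v, hv, hvle⟩ := (hKc.inter_right (isClosed_le continuous_const
      (continuous_id.sub continuous_const).norm : IsClosed {η | ε ≤ ‖η - z‖})).exists_forall_le'
      (f := V) (a := 0) hV.continuousOn (fun η hη => (hpos η hη.1.1 hη.1.2 (fun h => by
        have := hη.2
        simp only [h, mem_ofPred_eq, sub_self, norm_zero] at this
        linarith)).1)
    obtain ⟨w, hw, hwle⟩ := (hKc.inter_right (isClosed_le continuous_const hV :
      IsClosed {η | v / 2 ≤ V η})).exists_forall_le'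
      (f := W) (a := 0) hW.continuousOn (fun η hη => (hpos η hη.1.1 hη.1.2 (fun h => by
        have := hη.2
        simp only [h, mem_ofPred_eq, hVz] at this
        linarith)).2)
    refine ⟨v, hv, w, hw, fun η hη hηr => ⟨fun h => ?_, fun h => hwle η ⟨⟨hη, hηr⟩, h⟩⟩⟩
    by_contra! hcon
    exact absurd (hvle η ⟨⟨hη, hηr⟩, hcon⟩) (not_le.2 h)
  obtain ⟨v, hv, w, hw, hvw⟩ := hlow (r / 2) (half_pos hr)
  -- a single step from a point of a sublevel set
  set I : Set X := {η | η ∈ S ∧ ‖η - z‖ < r / 2} with hI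
  have hIr : ∀ η ∈ I, η ∈ closedBall z r := fun η hη => by
    rw [mem_closedBall, dist_eq_norm]; linarith [hη.2]
  -- With `γ ≤ r / (2 * C)` a step from the half ball stays in the full ball, where `V < v` forces
  -- it back into the half ball. The bound `γ ≤ 1` controls the perturbation where `V` is small.
  set γs := min (min γ₁ (r / (2 * C))) 1 with hγs
  have hγs0 : 0 < γs := by positivity
  have hsmall : ∀ c > 0, ∃ δ₀ > 0, δ₀ ≤ δ₁ ∧ ∀ δ, 0 < δ → δ ≤ δ₀ → C * δ ^ 2 ≤ c := by
    intro c hc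
    refine ⟨min (min δ₁ 1) (c / C), by positivity, (min_le_left _ _).trans (min_le_left _ _), ?_⟩
    intro δ hδ hle
    have h1 : δ ≤ 1 := hle.trans ((min_le_left _ _).trans (min_le_right _ _))
    have h2 : δ ≤ c / C := hle.trans (min_le_right _ _)
    calc C * δ ^ 2 ≤ C * δ := by gcongr; nlinarith
      _ ≤ C * (c / C) := by gcongr
      _ = c := by field_simp
  obtain ⟨δb, hδb, hδb1, hδbC⟩ := hsmall (min (v / 4) w) (by positivity)
  have hinv : ∀ δx > 0, ∀ δu > 0, δx + δu ≤ δb → ∀ γ ∈ Ioc 0 γs, ∀ η ∈ I, V η < v →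
      ∀ η', Step δx δu γ η η' → (η' ∈ I ∧ V η' < v) ∧
        V η' ≤ V η - γ * W η + γ * (C * (δx + δu) ^ 2) := by
    intro δx hδx δu hδu hδ γ hγ η hη hVη η' hst
    have hγ1 : γ ≤ 1 := hγ.2.trans (min_le_right _ _)
    obtain ⟨h1, h2, h3⟩ := hstep δx hδx δu hδu (hδ.trans hδb1) γ
      ⟨hγ.1, hγ.2.trans ((min_le_left _ _).trans (min_le_left _ _))⟩ η hη.1 (hIr η hη) η' hst
    have hCγ : C * γ ≤ r / 2 := by
      have : γ ≤ r / (2 * C) := hγ.2.trans ((min_le_left _ _).trans (min_le_right _ _))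
      calc C * γ ≤ C * (r / (2 * C)) := by gcongr
        _ = r / 2 := by field_simp
    have hη'r : η' ∈ closedBall z r := by
      rw [mem_closedBall, dist_eq_norm]
      calc ‖η' - z‖ = ‖(η' - η) + (η - z)‖ := by congr 1; abel
        _ ≤ ‖η' - η‖ + ‖η - z‖ := norm_add_le _ _
        _ ≤ r := by linarith [hη.2]
    have hδC := hδbC (δx + δu) (by positivity) hδ
    have hV' : V η' < v := by
      -- In the upper half of the sublevel set the decrease `W ≥ w` outweighs the perturbation; in
      -- the lower half the perturbation, at most `v / 4`, cannot lift `V` to `v`.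
      rcases le_total (v / 2) (V η) with h | h
      · have hw' := (hvw η hη.1 (hIr η hη)).2 h
        have : γ * (C * (δx + δu) ^ 2) ≤ γ * W η :=
          mul_le_mul_of_nonneg_left ((hδC.trans (min_le_right _ _)).trans hw') hγ.1.le
        linarith
      · have h4 : γ * (C * (δx + δu) ^ 2) ≤ 1 * (v / 4) :=
          mul_le_mul hγ1 (hδC.trans (min_le_left _ _)) (by positivity) zero_le_one
        have := mul_nonneg hγ.1.le (hW0 η)
        linarith
    exact ⟨⟨⟨h1, (hvw η' h1 hη'r).1 hV'⟩, hV'⟩, h3⟩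
  obtain ⟨ρ, hρ, hρV⟩ := Metric.continuousAt_iff.1 (hV.continuousAt (x := z)) v hv
  have hrun : ∀ δx > 0, ∀ δu > 0, δx + δu ≤ δb → ∀ γ ∈ Ioc 0 γs, ∀ η : ℕ → X, η 0 ∈ S →
        (∀ k, Step δx δu γ (η k) (η (k + 1))) → η 0 ∈ ball z (min ρ (r / 2)) →
        ∀ k, η k ∈ I ∧ V (η k) < v := by
    intro δx hδx δu hδu hδ γ hγ η h0 hst hball k
    induction k with
    | zero =>
      rw [mem_ball] at hball
      refine ⟨⟨h0, ?_⟩, ?_⟩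
      · rw [← dist_eq_norm]; exact hball.trans_le (min_le_right _ _)
      · have := hρV (hball.trans_le (min_le_left _ _))
        rw [hVz, Real.dist_eq, sub_zero] at this
        exact (le_abs_self _).trans_lt this
    | succ k ih => exact (hinv δx hδx δu hδu hδ γ hγ (η k) ih.1 ih.2 _ (hst k)).1
  refine ⟨γs, hγs0, δb, hδb, min ρ (r / 2), by positivity, ?_, ?_⟩
  · intro δx hδx δu hδu hδ γ hγ η h0 hst hball k
    linarith [(hrun δx hδx δu hδu hδ γ hγ η h0 hst hball k).1.2]
  · intro ε hε
    obtain ⟨v', hv', w', hw', hvw'⟩ := hlow ε hε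
    -- Allowing the perturbation only half of `w'` leaves a net decrease of `γ * (w' / 2)` per step
    -- while `V ≥ v' / 2`. This fixes `N`, uniformly over runs.
    obtain ⟨δ₀, hδ₀, -, hδ₀C⟩ := hsmall (min (v' / 4) (w' / 2)) (by positivity)
    refine ⟨δ₀, hδ₀, fun δx hδx δu hδu hδ hδ' γ hγ => ?_⟩
    have hγ1 : γ ≤ 1 := hγ.2.trans (min_le_right _ _)
    have hγ0 := hγ.1
    have hδC := hδ₀C (δx + δu) (by positivity) hδ'
    obtain ⟨N, hN⟩ := exists_nat_gt (v / (γ * (w' / 2)))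
    rw [div_lt_iff₀ (by positivity)] at hN
    refine ⟨N, fun η h0 hst hball => ?_⟩
    have hall := hrun δx hδx δu hδu hδ γ hγ η h0 hst hball
    have hdec := fun k => (hinv δx hδx δu hδu hδ γ hγ (η k) (hall k).1 (hall k).2 _ (hst k)).2
    have hdec2 : ∀ k, v' / 2 ≤ V (η k) → V (η (k + 1)) ≤ V (η k) - γ * (w' / 2) := by
      intro k hk
      have hw2 := (hvw' (η k) (hall k).1.1 (hIr _ (hall k).1)).2 hk
      have h1 : γ * w' ≤ γ * W (η k) := mul_le_mul_of_nonneg_left hw2 hγ0.le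
      have h2 : γ * (C * (δx + δu) ^ 2) ≤ γ * (w' / 2) :=
        mul_le_mul_of_nonneg_left (hδC.trans (min_le_right _ _)) hγ0.le
      linarith [hdec k]
    have hkeep : ∀ k, V (η k) < v' → V (η (k + 1)) < v' := by
      intro k hk
      rcases le_total (v' / 2) (V (η k)) with h | h
      · have : 0 < γ * (w' / 2) := by positivity
        linarith [hdec2 k h]
      · have h4 : γ * (C * (δx + δu) ^ 2) ≤ 1 * (v' / 4) :=
          mul_le_mul hγ1 (hδC.trans (min_le_left _ _)) (by positivity) zero_le_one
        have := mul_nonneg hγ.1.le (hW0 (η k))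
        linarith [hdec k]
    have hreach : ∀ k : ℕ, V (η k) < v' ∨ V (η k) ≤ v - k * (γ * (w' / 2)) := by
      intro k
      induction k with
      | zero => right; simpa using (hall 0).2.le
      | succ k ih =>
        by_cases hk : V (η k) < v'
        · exact .inl (hkeep k hk)
        · right
          have := hdec2 k (by linarith [not_lt.1 hk])
          have := ih.resolve_left hk
          push_cast
          linarith
    intro k hk
    suffices hlt : V (η k) < v' from
      ((hvw' (η k) (hall k).1.1 (hIr _ (hall k).1)).1 hlt).le
    refine Nat.le_induction ?_ (fun j _ hj => hkeep j hj) k hk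
    refine (hreach N).resolve_right fun h => ?_
    linarith [hV0 (η N) (hall N).1.1 (hIr _ (hall N).1)]

end Stability

end DataDrivenPronto

end

noncomputable section

namespace DataDrivenPronto

open Metric Set

variable {n m T : ℕ}

/-! ### Derivatives of separable costs. -/

section SumComp

variable {X Y Z : Type*} [NormedAddCommGroup X] [NormedSpace ℝ X] [NormedAddCommGroup Y]
  [NormedSpace ℝ Y] [NormedAddCommGroup Z] [NormedSpace ℝ Z] {ι : Type*} [Fintype ι]
  {g : ι → Y → ℝ} {h : Z → ℝ}

theorem fderiv_sum_comp_add_comp (hg : ∀ i, ContDiff ℝ 1 (g i)) (hh : ContDiff ℝ 1 h)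
    (L : ι → X →L[ℝ] Y) (K : X →L[ℝ] Z) (x v : X) :
    fderiv ℝ (fun y => ∑ i, g i (L i y) + h (K y)) x v =
      ∑ i, fderiv ℝ (g i) (L i x) (L i v) + fderiv ℝ h (K x) (K v) := by
  have h : HasFDerivAt (fun y => ∑ i, g i (L i y) + h (K y))
      (∑ i, (fderiv ℝ (g i) (L i x)).comp (L i) + (fderiv ℝ h (K x)).comp K) x := by
    refine HasFDerivAt.add (HasFDerivAt.fun_sum fun i _ => ?_) ?_
    · exact ((hg i).differentiable one_ne_zero _).hasFDerivAt.comp x (L i).hasFDerivAt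
    · exact (hh.differentiable one_ne_zero _).hasFDerivAt.comp x K.hasFDerivAt
  rw [h.fderiv]
  simp

theorem hasFDerivAt_fderiv_comp_apply {h : Z → ℝ} (hh : ContDiff ℝ 2 h) (K : X →L[ℝ] Z)
    (x w : X) : HasFDerivAt (fun y => fderiv ℝ h (K y) (K w))
      (((fderiv ℝ (fderiv ℝ h) (K x)).comp K).flip (K w)) x := by
  have h1 : HasFDerivAt (fun y => fderiv ℝ h (K y)) ((fderiv ℝ (fderiv ℝ h) (K x)).comp K) x :=
    (((hh.fderiv_right (m := 1) (by norm_num)).differentiable one_ne_zero _).hasFDerivAt).comp x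
      K.hasFDerivAt
  simpa using h1.clm_apply (hasFDerivAt_const (K w) x)

theorem fderiv_fderiv_sum_comp_add_comp (hg : ∀ i, ContDiff ℝ 2 (g i)) (hh : ContDiff ℝ 2 h)
    (L : ι → X →L[ℝ] Y) (K : X →L[ℝ] Z) (x v w : X) :
    fderiv ℝ (fderiv ℝ fun y => ∑ i, g i (L i y) + h (K y)) x v w =
      ∑ i, fderiv ℝ (fderiv ℝ (g i)) (L i x) (L i v) (L i w) +
        fderiv ℝ (fderiv ℝ h) (K x) (K v) (K w) := by
  set F : X → ℝ := fun y => ∑ i, g i (L i y) + h (K y) with hF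
  have hFc : ContDiff ℝ 2 F :=
    (ContDiff.sum fun i _ => (hg i).comp (L i).contDiff).add (hh.comp K.contDiff)
  have h1 : HasFDerivAt (fun y => fderiv ℝ F y w)
      (∑ i, ((fderiv ℝ (fderiv ℝ (g i)) (L i x)).comp (L i)).flip (L i w) +
        ((fderiv ℝ (fderiv ℝ h) (K x)).comp K).flip (K w)) x := by
    have : (fun y => fderiv ℝ F y w) = fun y =>
        ∑ i, fderiv ℝ (g i) (L i y) (L i w) + fderiv ℝ h (K y) (K w) :=
      funext fun y => fderiv_sum_comp_add_comp (fun i => (hg i).of_le (by norm_num))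
        (hh.of_le (by norm_num)) L K y w
    rw [this]
    exact HasFDerivAt.add (HasFDerivAt.fun_sum fun i _ => hasFDerivAt_fderiv_comp_apply (hg i) _ x w)
      (hasFDerivAt_fderiv_comp_apply hh _ x w)
  have h0 : HasFDerivAt (fderiv ℝ F) (fderiv ℝ (fderiv ℝ F) x) x :=
    ((hFc.fderiv_right (m := 1) (by norm_num)).differentiable one_ne_zero x).hasFDerivAt
  have h2 := h0.clm_apply (hasFDerivAt_const w x)
  simpa using DFunLike.congr_fun (h2.unique h1) v

end SumComp

/-! ### Coordinates on the space of curves. -/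

namespace Curve

theorem ext_iff' {η ζ : Curve n m T} :
    η = ζ ↔ (∀ t, x η t = x ζ t) ∧ ∀ t, u η t = u ζ t := by
  refine ⟨by rintro rfl; simp, fun h => ?_⟩
  apply WithLp.ofLp_injective
  exact Prod.ext (WithLp.ofLp_injective _ (funext h.1)) (WithLp.ofLp_injective _ (funext h.2))

/-- The state at time `t` as a linear function of the curve. -/
def xL (t : Fin (T + 1)) : Curve n m T →L[ℝ] E n :=
  (PiLp.proj 2 (fun _ : Fin (T + 1) => E n) t).comp ((ContinuousLinearMap.fst ℝ _ _).comp
    (WithLp.prodContinuousLinearEquiv 2 ℝ (PiLp 2 fun _ : Fin (T + 1) => E n)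
      (PiLp 2 fun _ : Fin T => E m)).toContinuousLinearMap)

/-- The input at time `t` as a linear function of the curve. -/
def uL (t : Fin T) : Curve n m T →L[ℝ] E m :=
  (PiLp.proj 2 (fun _ : Fin T => E m) t).comp ((ContinuousLinearMap.snd ℝ _ _).comp
    (WithLp.prodContinuousLinearEquiv 2 ℝ (PiLp 2 fun _ : Fin (T + 1) => E n)
      (PiLp 2 fun _ : Fin T => E m)).toContinuousLinearMap)

/-- The state-input pair at time `t` as a linear function of the curve. -/
def xuL (t : Fin T) : Curve n m T →L[ℝ] E n × E m := (xL t.castSucc).prod (uL t)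

/-- The input sequence as a linear function of the curve. -/
def inputs : Curve n m T →L[ℝ] (Fin T → E m) := ContinuousLinearMap.pi uL

/-- The sequence of states before the final time as a linear function of the curve. -/
def states : Curve n m T →L[ℝ] (Fin T → E n) := ContinuousLinearMap.pi fun t => xL t.castSucc

/-- The curve with given states and inputs. -/
def ofXU : ((Fin (T + 1) → E n) × (Fin T → E m)) →L[ℝ] Curve n m T :=
  (WithLp.prodContinuousLinearEquiv 2 ℝ (PiLp 2 fun _ : Fin (T + 1) => E n)
      (PiLp 2 fun _ : Fin T => E m)).symm.toContinuousLinearMap.comp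
    ((PiLp.continuousLinearEquiv 2 ℝ fun _ : Fin (T + 1) => E n).symm.toContinuousLinearMap.prodMap
      (PiLp.continuousLinearEquiv 2 ℝ fun _ : Fin T => E m).symm.toContinuousLinearMap)

@[simp] theorem xL_apply (t : Fin (T + 1)) (η : Curve n m T) : xL t η = x η t := rfl
@[simp] theorem uL_apply (t : Fin T) (η : Curve n m T) : uL t η = u η t := rfl
@[simp] theorem xuL_apply (t : Fin T) (η : Curve n m T) : xuL t η = xu η t := rfl
@[simp] theorem x_ofXU (p : (Fin (T + 1) → E n) × (Fin T → E m)) (t : Fin (T + 1)) :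
    x (ofXU p) t = p.1 t := rfl
@[simp] theorem u_ofXU (p : (Fin (T + 1) → E n) × (Fin T → E m)) (t : Fin T) :
    u (ofXU p) t = p.2 t := rfl

theorem norm_x_le (η : Curve n m T) (t : Fin (T + 1)) : ‖x η t‖ ≤ ‖η‖ :=
  (PiLp.norm_apply_le η.fst t).trans (WithLp.norm_fst_le _ η)

theorem norm_u_le (η : Curve n m T) (t : Fin T) : ‖u η t‖ ≤ ‖η‖ :=
  (PiLp.norm_apply_le η.snd t).trans (WithLp.norm_snd_le _ η)

theorem norm_xu_le (η : Curve n m T) (t : Fin T) : ‖xu η t‖ ≤ ‖η‖ :=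
  max_le (norm_x_le η _) (norm_u_le η t)

theorem norm_inputs_le (η : Curve n m T) : ‖inputs η‖ ≤ ‖η‖ :=
  (pi_norm_le_iff_of_nonneg (norm_nonneg _)).2 fun t => norm_u_le η t

theorem norm_states_le (η : Curve n m T) : ‖states η‖ ≤ ‖η‖ :=
  (pi_norm_le_iff_of_nonneg (norm_nonneg _)).2 fun t => norm_x_le η t.castSucc

end Curve

open Curve

/-! ### Linear time-varying responses. -/

/-- `ζ` is a response from the initial state `0` of the linear time-varying system with
dynamics `A`. -/
def IsLinearResponse (A : Fin T → E n × E m →L[ℝ] E n) (ζ : Curve n m T) : Prop :=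
  x ζ 0 = 0 ∧ ∀ t : Fin T, x ζ t.succ = A t (xu ζ t)

theorem exists_isLinearResponse (A : Fin T → E n × E m →L[ℝ] E n) (v : Fin T → E m) :
    ∃ ζ : Curve n m T, IsLinearResponse A ζ ∧ inputs ζ = v := by
  exact ⟨ofXU (fun t => Fin.induction (motive := fun _ => E n) 0 (fun t y => A t (y, v t)) t, v),
    ⟨rfl, fun _ => rfl⟩, rfl⟩

theorem IsLinearResponse.add_smul {A : Fin T → E n × E m →L[ℝ] E n} {ζ ζ' : Curve n m T}
    (h : IsLinearResponse A ζ) (h' : IsLinearResponse A ζ') (s : ℝ) :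
    IsLinearResponse A (ζ + s • ζ') := by
  refine ⟨?_, fun t => ?_⟩
  · rw [← xL_apply, map_add, map_smul, xL_apply, xL_apply, h.1, h'.1, smul_zero, add_zero]
  · rw [← xL_apply, ← xuL_apply, map_add, map_add, map_smul, map_smul, map_add, map_smul,
      xL_apply, xL_apply, h.2, h'.2, xuL_apply, xuL_apply]

/-- Responses of nearby linear systems to the same input are close. -/
theorem exists_norm_sub_le_of_isLinearResponse (n m T : ℕ) {a : ℝ} (ha : 0 ≤ a) :
    ∃ C > 0, ∀ ε ≥ 0, ∀ A₁ A₂ : Fin T → E n × E m →L[ℝ] E n, (∀ t, ‖A₁ t‖ ≤ a) →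
      (∀ t, ‖A₁ t - A₂ t‖ ≤ ε) → ∀ ζ₁ ζ₂ : Curve n m T, IsLinearResponse A₁ ζ₁ →
      IsLinearResponse A₂ ζ₂ → inputs ζ₁ = inputs ζ₂ → ‖ζ₁ - ζ₂‖ ≤ C * ε * ‖ζ₂‖ := by
  refine ⟨(‖(ofXU : _ →L[ℝ] Curve n m T)‖ + 1) * (a + 1) ^ T, by positivity, ?_⟩
  intro ε hε A₁ A₂ hA hAA ζ₁ ζ₂ h₁ h₂ hu
  have hstep : ∀ t : Fin (T + 1), ‖x ζ₁ t - x ζ₂ t‖ ≤ (a + 1) ^ (t : ℕ) * (ε * ‖ζ₂‖) := by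
    intro t
    induction t using Fin.induction with
    | zero => rw [h₁.1, h₂.1, sub_self, norm_zero]; positivity
    | succ t ih =>
      have hut : u ζ₁ t = u ζ₂ t := congrFun hu t
      -- Discrete Grönwall: the inputs cancel, so the state error is propagated by `A₁` and forced
      -- by the model mismatch acting on `ζ₂`.
      have hdec : x ζ₁ t.succ - x ζ₂ t.succ =
          A₁ t (x ζ₁ t.castSucc - x ζ₂ t.castSucc, 0) + (A₁ t - A₂ t) (xu ζ₂ t) := by
        have : (x ζ₁ t.castSucc - x ζ₂ t.castSucc, (0 : E m)) = xu ζ₁ t - xu ζ₂ t := by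
          simp [xu, hut]
        rw [this, map_sub, sub_apply, h₁.2, h₂.2]
        abel
      have e1 : ‖A₁ t (x ζ₁ t.castSucc - x ζ₂ t.castSucc, 0)‖ ≤
          a * ((a + 1) ^ (t : ℕ) * (ε * ‖ζ₂‖)) := by
        refine (A₁ t).le_of_opNorm_le_of_le (hA t) ?_
        simpa [Prod.norm_def] using ih
      have e2 : ‖(A₁ t - A₂ t) (xu ζ₂ t)‖ ≤ ε * ‖ζ₂‖ :=
        (A₁ t - A₂ t).le_of_opNorm_le_of_le (hAA t) (norm_xu_le ζ₂ t)
      have e3 : 1 * (ε * ‖ζ₂‖) ≤ (a + 1) ^ (t : ℕ) * (ε * ‖ζ₂‖) := by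
        gcongr
        exact one_le_pow₀ (by linarith)
      rw [hdec, Fin.val_succ, pow_succ]
      refine (norm_add_le _ _).trans ?_
      linarith
  have hmk : ζ₁ - ζ₂ = ofXU (fun t => x ζ₁ t - x ζ₂ t, 0) := by
    rw [ext_iff']
    refine ⟨fun t => rfl, fun t => ?_⟩
    have hut : u ζ₁ t = u ζ₂ t := congrFun hu t
    rw [← uL_apply, map_sub, uL_apply, uL_apply, hut, sub_self]
    rfl
  have hle : ‖((fun t => x ζ₁ t - x ζ₂ t, 0) : (Fin (T + 1) → E n) × (Fin T → E m))‖ ≤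
      (a + 1) ^ T * (ε * ‖ζ₂‖) := by
    rw [Prod.norm_def]
    refine max_le ((pi_norm_le_iff_of_nonneg (by positivity)).2 fun t => ?_)
      (by simp only [norm_zero]; positivity)
    refine (hstep t).trans ?_
    gcongr
    · linarith
    · exact Nat.lt_succ_iff.1 t.isLt
  calc ‖ζ₁ - ζ₂‖ ≤ ‖(ofXU : _ →L[ℝ] Curve n m T)‖ * ((a + 1) ^ T * (ε * ‖ζ₂‖)) := by
        rw [hmk]; exact ofXU.le_of_opNorm_le_of_le le_rfl hle
    _ ≤ (‖(ofXU : _ →L[ℝ] Curve n m T)‖ + 1) * ((a + 1) ^ T * (ε * ‖ζ₂‖)) := by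
        gcongr; linarith
    _ = _ := by ring

/-- This is the comparison estimate with zero mismatch; `∑ t, ‖A t‖` serves as the uniform bound. -/
theorem IsLinearResponse.eq_of_inputs_eq {A : Fin T → E n × E m →L[ℝ] E n} {ζ ζ' : Curve n m T}
    (h : IsLinearResponse A ζ) (h' : IsLinearResponse A ζ') (hu : inputs ζ = inputs ζ') :
    ζ = ζ' := by
  obtain ⟨C, -, hC⟩ := exists_norm_sub_le_of_isLinearResponse n m T
    (Finset.sum_nonneg fun t _ => norm_nonneg (A t) : 0 ≤ ∑ t, ‖A t‖)
  have := hC 0 le_rfl A A (fun t => Finset.single_le_sum (f := fun t => ‖A t‖)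
    (fun t _ => norm_nonneg (A t)) (Finset.mem_univ t)) (by simp) ζ ζ' h h' hu
  rw [mul_zero, zero_mul, norm_le_zero_iff] at this
  exact sub_eq_zero.1 this

/-! ### Closed loops, the projection and the reduced cost. -/

namespace OptimalControlProblem

variable (P : OptimalControlProblem n m T) (π : E n → E m → E n → ℕ → E m)

/-- The states of the closed loop with initial state and reference `p`. -/
def closedLoopState (p : E n × (Fin T → E n) × (Fin T → E m)) (t : Fin (T + 1)) : E n :=
  Fin.induction (motive := fun _ => E n) p.1
    (fun t y => P.f (y, π (p.2.1 t) (p.2.2 t) y t)) t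

/-- The closed-loop response with initial state and reference `p`. -/
def closedLoop (p : E n × (Fin T → E n) × (Fin T → E m)) : Curve n m T :=
  ofXU (P.closedLoopState π p,
    fun t => π (p.2.1 t) (p.2.2 t) (P.closedLoopState π p t.castSucc) t)

theorem isClosedLoop_closedLoop (p : E n × (Fin T → E n) × (Fin T → E m)) :
    P.IsClosedLoop π p.1 p.2.1 p.2.2 (P.closedLoop π p) :=
  ⟨rfl, fun _ => ⟨rfl, rfl⟩⟩

variable {P π}

theorem IsClosedLoop.unique {x₀ : E n} {α : Fin T → E n} {μ : Fin T → E m} {η η' : Curve n m T}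
    (h : P.IsClosedLoop π x₀ α μ η) (h' : P.IsClosedLoop π x₀ α μ η') : η = η' := by
  have hx : ∀ t, x η t = x η' t := by
    intro t
    induction t using Fin.induction with
    | zero => rw [h.1, h'.1]
    | succ t ih => rw [(h.2 t).2, (h'.2 t).2, xu, xu, (h.2 t).1, (h'.2 t).1, ih]
  exact ext_iff'.2 ⟨hx, fun t => by rw [(h.2 t).1, (h'.2 t).1, hx]⟩

theorem IsClosedLoop.eq_closedLoop {x₀ : E n} {α : Fin T → E n} {μ : Fin T → E m}
    {η : Curve n m T} (h : P.IsClosedLoop π x₀ α μ η) : η = P.closedLoop π (x₀, α, μ) :=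
  h.unique (P.isClosedLoop_closedLoop π (x₀, α, μ))

theorem IsClosedLoop.isTrajectory {α : Fin T → E n} {μ : Fin T → E m} {η : Curve n m T}
    (h : P.IsClosedLoop π P.xInit α μ η) : P.IsTrajectory η :=
  ⟨h.1, fun t => (h.2 t).2⟩

theorem contDiff_closedLoop {k : WithTop ℕ∞} (hf : ContDiff ℝ k P.f)
    (hπ : ∀ t : ℕ, ContDiff ℝ k (fun p : E n × E m × E n => π p.1 p.2.1 p.2.2 t)) :
    ContDiff ℝ k (P.closedLoop π) := by
  have hα : ∀ t : Fin T, ContDiff ℝ k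
      fun p : E n × (Fin T → E n) × (Fin T → E m) => p.2.1 t := fun t => by fun_prop
  have hμ : ∀ t : Fin T, ContDiff ℝ k
      fun p : E n × (Fin T → E n) × (Fin T → E m) => p.2.2 t := fun t => by fun_prop
  have hu : ∀ (t : Fin T) (s : Fin (T + 1)),
      ContDiff ℝ k (fun p => P.closedLoopState π p s) →
      ContDiff ℝ k fun p => π (p.2.1 t) (p.2.2 t) (P.closedLoopState π p s) t :=
    fun t s hs => (hπ t).comp ((hα t).prodMk ((hμ t).prodMk hs))
  have hx : ∀ t, ContDiff ℝ k fun p => P.closedLoopState π p t := by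
    intro t
    induction t using Fin.induction with
    | zero => exact contDiff_fst
    | succ t ih =>
      have : (fun p => P.closedLoopState π p t.succ) = fun p => P.f
          (P.closedLoopState π p t.castSucc,
            π (p.2.1 t) (p.2.2 t) (P.closedLoopState π p t.castSucc) t) :=
        rfl
      rw [this]
      exact hf.comp (ih.prodMk (hu t _ ih))
  exact ofXU.contDiff.comp ((contDiff_pi.2 hx).prodMk (contDiff_pi.2 fun t => hu t _ (hx _)))

variable (P π)

/-- The closed-loop projection onto the trajectory manifold. -/
def proj (ξ : Curve n m T) : Curve n m T := P.closedLoop π (P.xInit, states ξ, inputs ξ)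

/-- The trajectory with a given input. -/
def response (v : Fin T → E m) : Curve n m T :=
  -- The open-loop controller ignores the state reference, so `0` is a dummy value.
  P.closedLoop (fun _ μ _ _ => μ) (P.xInit, 0, v)

variable {P π}

theorem contDiff_proj {k : WithTop ℕ∞} (hf : ContDiff ℝ k P.f)
    (hπ : ∀ t : ℕ, ContDiff ℝ k (fun p : E n × E m × E n => π p.1 p.2.1 p.2.2 t)) :
    ContDiff ℝ k (P.proj π) :=
  (contDiff_closedLoop hf hπ).comp
    (contDiff_const.prodMk (states.contDiff.prodMk inputs.contDiff))

theorem contDiff_response {k : WithTop ℕ∞} (hf : ContDiff ℝ k P.f) :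
    ContDiff ℝ k P.response :=
  (contDiff_closedLoop hf fun _ => contDiff_fst.comp contDiff_snd).comp
    (contDiff_const.prodMk (contDiff_const.prodMk contDiff_id))

theorem isTrajectory_response (v : Fin T → E m) : P.IsTrajectory (P.response v) :=
  IsClosedLoop.isTrajectory (P.isClosedLoop_closedLoop _ (P.xInit, 0, v))

theorem IsTrajectory.isClosedLoop (hπ_track : ∀ α μ t, π α μ α t = μ) {η : Curve n m T}
    (h : P.IsTrajectory η) : P.IsClosedLoop π P.xInit (states η) (inputs η) η :=
  ⟨h.1, fun t => ⟨(hπ_track _ _ _).symm, h.2 t⟩⟩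

theorem IsTrajectory.proj_eq (hπ_track : ∀ α μ t, π α μ α t = μ) {η : Curve n m T}
    (h : P.IsTrajectory η) : P.proj π η = η :=
  (h.isClosedLoop hπ_track).eq_closedLoop.symm

theorem IsTrajectory.response_inputs {η : Curve n m T} (h : P.IsTrajectory η) :
    P.response (inputs η) = η :=
  (IsClosedLoop.eq_closedLoop (π := fun _ μ _ _ => μ) (α := 0) (μ := inputs η)
    ⟨h.1, fun t => ⟨rfl, h.2 t⟩⟩).symm

theorem isClosed_isTrajectory (hf : Continuous P.f) : IsClosed {η | P.IsTrajectory η} := by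
  have : {η | P.IsTrajectory η} =
      {η | xL 0 η = P.xInit} ∩ ⋂ t : Fin T, {η | xL t.succ η = P.f (xuL t η)} := by
    ext η; simp [IsTrajectory]
  rw [this]
  exact (isClosed_eq (xL 0).continuous continuous_const).inter
    (isClosed_iInter fun t => isClosed_eq (xL _).continuous (hf.comp (xuL t).continuous))

/-- Differentiating the initial condition and the dynamics satisfied by `P.response` gives the
linearized equations. -/
theorem isTangent_fderiv_response (hf : ContDiff ℝ 1 P.f) (v w : Fin T → E m) :
    P.IsTangent (P.response v) (fderiv ℝ P.response v w) := by
  have hd : HasFDerivAt P.response (fderiv ℝ P.response v) v :=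
    ((contDiff_response hf).differentiable one_ne_zero v).hasFDerivAt
  refine ⟨?_, fun t => ?_⟩
  · have h1 : HasFDerivAt (𝕜 := ℝ) (fun v => xL 0 (P.response v))
        ((xL 0).comp (fderiv ℝ P.response v)) v := (xL 0).hasFDerivAt.comp v hd
    have h2 : HasFDerivAt (𝕜 := ℝ) (fun v => xL 0 (P.response v)) 0 v := by
      have : (fun v => xL 0 (P.response v)) = fun _ => P.xInit :=
        funext fun v => (isTrajectory_response (P := P) v).1
      rw [this]
      exact hasFDerivAt_const P.xInit v
    simpa using DFunLike.congr_fun (h1.unique h2) w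
  · have h1 : HasFDerivAt (fun v => xL t.succ (P.response v))
        ((xL t.succ).comp (fderiv ℝ P.response v)) v := (xL t.succ).hasFDerivAt.comp v hd
    have h2 : HasFDerivAt (fun v => P.f (xuL t (P.response v)))
        ((fderiv ℝ P.f (xuL t (P.response v))).comp
          ((xuL t).comp (fderiv ℝ P.response v))) v :=
      ((hf.differentiable one_ne_zero _).hasFDerivAt).comp v ((xuL t).hasFDerivAt.comp v hd)
    have : (fun v => xL t.succ (P.response v)) = fun v => P.f (xuL t (P.response v)) :=
      funext fun v => (isTrajectory_response v).2 t
    rw [← this] at h2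
    simpa using DFunLike.congr_fun (h1.unique h2) w

theorem inputs_fderiv_response (hf : ContDiff ℝ 1 P.f) (v w : Fin T → E m) :
    inputs (fderiv ℝ P.response v w) = w := by
  have hd : HasFDerivAt P.response (fderiv ℝ P.response v) v :=
    ((contDiff_response hf).differentiable one_ne_zero v).hasFDerivAt
  have h1 : HasFDerivAt (fun v => inputs (P.response v))
    (inputs.comp (fderiv ℝ P.response v)) v := inputs.hasFDerivAt.comp v hd
  exact DFunLike.congr_fun (h1.unique (hasFDerivAt_id v)) w

/-- Both sides are responses of the same linear system to the same input. Hence the derivative of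
`P.response` parametrizes the whole tangent space. -/
theorem IsTangent.eq_fderiv_response (hf : ContDiff ℝ 1 P.f) {η ζ : Curve n m T}
    (hη : P.IsTrajectory η) (h : P.IsTangent η ζ) :
    ζ = fderiv ℝ P.response (inputs η) (inputs ζ) := by
  have := isTangent_fderiv_response hf (inputs η) (inputs ζ)
  rw [hη.response_inputs] at this
  exact IsLinearResponse.eq_of_inputs_eq h this (inputs_fderiv_response hf _ _).symm

/-- The cost as a function of the input. -/
def reducedCost (P : OptimalControlProblem n m T) (v : Fin T → E m) : ℝ := P.cost (P.response v)

theorem contDiff_reducedCost {k : WithTop ℕ∞} (hf : ContDiff ℝ k P.f)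
    (hcost : ContDiff ℝ k P.cost) : ContDiff ℝ k P.reducedCost :=
  hcost.comp (contDiff_response hf)

theorem fderiv_reducedCost (hf : ContDiff ℝ 1 P.f) (hcost : ContDiff ℝ 1 P.cost)
    {η : Curve n m T} (hη : P.IsTrajectory η) (w : Fin T → E m) :
    fderiv ℝ P.reducedCost (inputs η) w =
      fderiv ℝ P.cost η (fderiv ℝ P.response (inputs η) w) := by
  have h := fderiv_comp (inputs η) (hcost.differentiable one_ne_zero (P.response (inputs η)))
    ((contDiff_response hf).differentiable one_ne_zero (inputs η))
  rw [hη.response_inputs] at h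
  exact DFunLike.congr_fun h w

/-- A trajectory is stationary exactly when its input is a critical point of the reduced cost. -/
theorem isStationary_iff (hf : ContDiff ℝ 1 P.f) (hcost : ContDiff ℝ 1 P.cost)
    {η : Curve n m T} (hη : P.IsTrajectory η) :
    P.IsStationary η ↔ fderiv ℝ P.reducedCost (inputs η) = 0 := by
  refine ⟨fun h => ?_, fun h => ⟨hη, fun ζ hζ => ?_⟩⟩
  · ext1 w
    rw [fderiv_reducedCost hf hcost hη]
    have := isTangent_fderiv_response hf (inputs η) w
    rw [hη.response_inputs] at this
    exact h.2 _ this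
  · rw [hζ.eq_fderiv_response hf hη, ← fderiv_reducedCost hf hcost hη, h]
    rfl

/-- Along tangent directions, precomposition with the projection does not change the derivative
of the cost. -/
theorem fderiv_cost_proj (hf : ContDiff ℝ 1 P.f) (hcost : ContDiff ℝ 1 P.cost)
    (hπ : ∀ t : ℕ, ContDiff ℝ 1 (fun p : E n × E m × E n => π p.1 p.2.1 p.2.2 t))
    (hπ_track : ∀ α μ t, π α μ α t = μ) {η ζ : Curve n m T} (hη : P.IsTrajectory η)
    (hζ : P.IsTangent η ζ) :
    fderiv ℝ (fun ξ => P.cost (P.proj π ξ)) η ζ = fderiv ℝ P.cost η ζ := by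
  have hr := (contDiff_response hf).differentiable one_ne_zero (inputs η)
  have hΨ : ContDiff ℝ 1 fun ξ => P.cost (P.proj π ξ) := hcost.comp (contDiff_proj hf hπ)
  have h1 := fderiv_comp (inputs η)
    (hΨ.differentiable one_ne_zero (P.response (inputs η))) hr
  have h2 := fderiv_comp (inputs η) (hcost.differentiable one_ne_zero (P.response (inputs η))) hr
  -- The projection fixes trajectories, so both costs agree along `P.response`, whose derivative
  -- reaches every tangent direction.
  have heq : (fun ξ => P.cost (P.proj π ξ)) ∘ P.response = P.cost ∘ P.response :=
    funext fun v => congrArg P.cost ((isTrajectory_response v).proj_eq hπ_track)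
  rw [heq, h2, hη.response_inputs] at h1
  rw [hζ.eq_fderiv_response hf hη]
  exact (DFunLike.congr_fun h1 (inputs ζ)).symm

/-! ### Stage costs and the quadratic model. -/

section Cost

/-- The curve that vanishes except for the state-input pair at time `t`. -/
def single (t : Fin T) : E n × E m →L[ℝ] Curve n m T :=
  ofXU.comp ((ContinuousLinearMap.single ℝ (fun _ : Fin (T + 1) => E n) t.castSucc).prodMap
    (ContinuousLinearMap.single ℝ (fun _ : Fin T => E m) t))

theorem xu_single_same (t : Fin T) (z : E n × E m) : xu (single t z) t = z := by
  simp [xu, single]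

theorem xu_single_of_ne {s t : Fin T} (h : s ≠ t) (z : E n × E m) : xu (single t z) s = 0 := by
  simp [xu, single, h]

/-- Smoothness is assumed only for the total cost; restricting it to curves supported at time `t`
recovers the stage cost up to a constant. -/
theorem contDiff_stageCost {k : WithTop ℕ∞} (hcost : ContDiff ℝ k P.cost) (t : Fin T) :
    ContDiff ℝ k (P.stageCost t) := by
  have : P.stageCost t = fun z => P.cost (single t z) -
      (∑ s ∈ Finset.univ.erase t, P.stageCost s 0 + P.terminalCost 0) := by
    funext z
    have hlast : x (single t z) (Fin.last T) = 0 := by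
      simp [single, (Fin.castSucc_lt_last t).ne']
    rw [cost, hlast, ← Finset.add_sum_erase _ _ (Finset.mem_univ t), xu_single_same,
      Finset.sum_congr rfl fun s hs => by rw [xu_single_of_ne (Finset.ne_of_mem_erase hs)]]
    ring
  rw [this]
  exact (hcost.comp (single t).contDiff).sub contDiff_const

theorem contDiff_terminalCost {k : WithTop ℕ∞} (hcost : ContDiff ℝ k P.cost) :
    ContDiff ℝ k P.terminalCost := by
  set L : E n →L[ℝ] Curve n m T := ofXU.comp ((ContinuousLinearMap.inl ℝ _ _).comp
    (ContinuousLinearMap.single ℝ (fun _ : Fin (T + 1) => E n) (Fin.last T))) with hL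
  have : P.terminalCost = fun z => P.cost (L z) - ∑ s, P.stageCost s 0 := by
    funext z
    have h1 : ∀ s : Fin T, xu (L z) s = 0 := fun s => by
      simp [xu, hL, (Fin.castSucc_lt_last s).ne]
    have h2 : x (L z) (Fin.last T) = z := by simp [hL]
    simp [cost, h1, h2]
  rw [this]
  exact (hcost.comp L.contDiff).sub contDiff_const

theorem fderiv_cost (hcost : ContDiff ℝ 1 P.cost) (η ζ : Curve n m T) :
    fderiv ℝ P.cost η ζ = ∑ t, fderiv ℝ (P.stageCost t) (xu η t) (xu ζ t) +
      fderiv ℝ P.terminalCost (x η (Fin.last T)) (x ζ (Fin.last T)) :=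
  fderiv_sum_comp_add_comp (fun t => contDiff_stageCost hcost t) (contDiff_terminalCost hcost)
    xuL (xL (Fin.last T)) η ζ

theorem fderiv_fderiv_cost (hcost : ContDiff ℝ 2 P.cost) (η v w : Curve n m T) :
    fderiv ℝ (fderiv ℝ P.cost) η v w =
      ∑ t, fderiv ℝ (fderiv ℝ (P.stageCost t)) (xu η t) (xu v t) (xu w t) +
      fderiv ℝ (fderiv ℝ P.terminalCost) (x η (Fin.last T)) (x v (Fin.last T))
        (x w (Fin.last T)) :=
  fderiv_fderiv_sum_comp_add_comp (fun t => contDiff_stageCost hcost t)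
    (contDiff_terminalCost hcost) xuL (xL (Fin.last T)) η v w

theorem lqrCost_eq (hcost : ContDiff ℝ 2 P.cost) (η ζ : Curve n m T) :
    P.lqrCost η ζ =
      1 / 2 * fderiv ℝ (fderiv ℝ P.cost) η ζ ζ + fderiv ℝ P.cost η ζ := by
  rw [fderiv_fderiv_cost hcost, fderiv_cost (hcost.of_le (by norm_num)), lqrCost,
    Finset.sum_add_distrib, mul_add, Finset.mul_sum]
  ring

end Cost

end OptimalControlProblem

end DataDrivenPronto

end

noncomputable section

namespace DataDrivenPronto

open Matrix

/-! ### Least squares with well-conditioned data. -/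

section LeastSquares

variable {ι κ : Type*} [Fintype ι] [DecidableEq ι] [Fintype κ]

/-- A right-invertible matrix times its pseudoinverse is the identity, and the Gram matrix of the
pseudoinverse is the inverse of that of the matrix. -/
theorem IsPseudoinverse.mul_eq_one {A : Matrix ι κ ℝ} {B : Matrix κ ι ℝ}
    (h : IsPseudoinverse A B) (hA : IsUnit (A * Aᵀ).det) :
    A * B = 1 ∧ Bᵀ * B = (A * Aᵀ)⁻¹ := by
  obtain ⟨h1, h2, h3, h4⟩ := h
  have hAB : A * B = 1 := by
    have : A * B * (A * Aᵀ) = A * Aᵀ := by rw [← Matrix.mul_assoc, h1]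
    calc A * B = A * B * (A * Aᵀ) * (A * Aᵀ)⁻¹ := by
          rw [Matrix.mul_assoc _ (A * Aᵀ), Matrix.mul_nonsing_inv _ hA, Matrix.mul_one]
      _ = 1 := by rw [this, Matrix.mul_nonsing_inv _ hA]
  refine ⟨hAB, (Matrix.inv_eq_right_inv ?_).symm⟩
  calc A * Aᵀ * (Bᵀ * B) = A * (B * A)ᵀ * B := by
        rw [Matrix.transpose_mul]; simp only [Matrix.mul_assoc]
    _ = A * B * (A * B) := by rw [h4]; simp only [Matrix.mul_assoc]
    _ = 1 := by rw [hAB, Matrix.one_mul]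

theorem dotProduct_mulVec_le_norm_mul (A : Matrix ι ι ℝ) (z : ι → ℝ) :
    z ⬝ᵥ (A *ᵥ z) ≤ ‖toEuclideanCLM (𝕜 := ℝ) A‖ * (z ⬝ᵥ z) := by
  have h := real_inner_le_norm (toEuclideanCLM (𝕜 := ℝ) A (WithLp.toLp 2 z)) (WithLp.toLp 2 z)
  have hz : ‖WithLp.toLp 2 z‖ * ‖WithLp.toLp 2 z‖ = z ⬝ᵥ z := by
    rw [← real_inner_self_eq_norm_mul_norm, EuclideanSpace.inner_eq_star_dotProduct]
    simp
  have hi : inner ℝ (toEuclideanCLM (𝕜 := ℝ) A (WithLp.toLp 2 z)) (WithLp.toLp 2 z) =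
      z ⬝ᵥ (A *ᵥ z) := by
    rw [EuclideanSpace.inner_eq_star_dotProduct]
    simp
  rw [hi] at h
  refine h.trans ?_
  rw [← hz, ← mul_assoc]
  exact mul_le_mul_of_nonneg_right (ContinuousLinearMap.le_opNorm _ _) (norm_nonneg _)

theorem trace_le_card_mul_norm (A : Matrix ι ι ℝ) :
    A.trace ≤ Fintype.card ι * ‖toEuclideanCLM (𝕜 := ℝ) A‖ := by
  rw [Matrix.trace, ← nsmul_eq_mul, ← Finset.card_univ]
  refine Finset.sum_le_card_nsmul _ _ _ fun i _ => ?_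
  have := dotProduct_mulVec_le_norm_mul A (Pi.single i 1)
  simpa using this

/-- The least-squares estimate from data `N = F D + R` with small relative residuals `R` is close
to `F` when the Gram matrix of `D` is well conditioned. -/
theorem leastSquares_error {ν : Type*} [Fintype ν] {D : Matrix ι κ ℝ} {B : Matrix κ ι ℝ}
    (hB : IsPseudoinverse D B) {M : ℝ}
    (hM : conditionNumber (D * Dᵀ) ≤ ENNReal.ofReal M) (F : Matrix ν ι ℝ) (N : Matrix ν κ ℝ)
    {q : ℝ} (hq : 0 ≤ q)
    (hres : ∀ i, ∑ a, (N a i - (F * D) a i) ^ 2 ≤ q * ∑ a, D a i ^ 2) (z : ι → ℝ) :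
    ∑ a, ((N * B - F) *ᵥ z) a ^ 2 ≤ q * (Fintype.card ι * max M 0) * ∑ a, z a ^ 2 := by
  -- A singular Gram matrix has condition number `⊤`, which no real `M` bounds.
  have hdet : IsUnit (D * Dᵀ).det := by
    by_contra h
    rw [conditionNumber, if_neg h, top_le_iff] at hM
    exact ENNReal.ofReal_ne_top hM
  rw [conditionNumber, if_pos hdet, ENNReal.ofReal_le_ofReal_iff'] at hM
  have hM' : ‖toEuclideanCLM (𝕜 := ℝ) (D * Dᵀ)‖ * ‖toEuclideanCLM (𝕜 := ℝ) (D * Dᵀ)⁻¹‖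
      ≤ max M 0 := hM.elim (fun h => h.trans (le_max_left _ _)) fun h => h.trans (le_max_right _ _)
  obtain ⟨hDB, hBB⟩ := hB.mul_eq_one hdet
  set y := B *ᵥ z with hy
  -- Since `D * B = 1`, the estimation error is the residual applied to `y = B z`. The residual is
  -- bounded through the trace of the Gram matrix and `y` through its inverse, so only the product
  -- of the two norms enters.
  have hNF : (N * B - F) *ᵥ z = (N - F * D) *ᵥ y := by
    rw [hy, Matrix.mulVec_mulVec, Matrix.sub_mul, Matrix.mul_assoc F, hDB, Matrix.mul_one]
  have hyy : ∑ i, y i ^ 2 ≤ ‖toEuclideanCLM (𝕜 := ℝ) (D * Dᵀ)⁻¹‖ * ∑ a, z a ^ 2 := by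
    have : ∑ i, y i ^ 2 = z ⬝ᵥ ((D * Dᵀ)⁻¹ *ᵥ z) := by
      rw [← hBB, ← Matrix.mulVec_mulVec, Matrix.dotProduct_mulVec, Matrix.vecMul_transpose]
      simp only [dotProduct, ← hy, sq]
    rw [this]
    refine (dotProduct_mulVec_le_norm_mul _ z).trans (le_of_eq ?_)
    simp only [dotProduct, sq]
  have hR : ∑ i, ∑ a, (N a i - (F * D) a i) ^ 2 ≤
      q * (Fintype.card ι * ‖toEuclideanCLM (𝕜 := ℝ) (D * Dᵀ)‖) := by
    calc _ ≤ ∑ i, q * ∑ a, D a i ^ 2 := Finset.sum_le_sum fun i _ => hres i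
      _ = q * (D * Dᵀ).trace := by
        rw [← Finset.mul_sum, Finset.sum_comm]
        simp only [Matrix.trace, Matrix.diag, Matrix.mul_apply, Matrix.transpose_apply, sq]
      _ ≤ _ := mul_le_mul_of_nonneg_left (trace_le_card_mul_norm _) hq
  have hCS : ∑ a, ((N - F * D) *ᵥ y) a ^ 2 ≤
      (∑ i, ∑ a, (N a i - (F * D) a i) ^ 2) * ∑ i, y i ^ 2 := by
    rw [Finset.sum_comm, Finset.sum_mul]
    exact Finset.sum_le_sum fun a _ => Finset.sum_mul_sq_le_sq_mul_sq _ _ _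
  rw [hNF]
  refine hCS.trans ?_
  have hz : 0 ≤ ∑ a, z a ^ 2 := Finset.sum_nonneg fun _ _ => sq_nonneg _
  calc _ ≤ (q * (Fintype.card ι * ‖toEuclideanCLM (𝕜 := ℝ) (D * Dᵀ)‖)) *
        (‖toEuclideanCLM (𝕜 := ℝ) (D * Dᵀ)⁻¹‖ * ∑ a, z a ^ 2) :=
        mul_le_mul hR hyy (Finset.sum_nonneg fun _ _ => sq_nonneg _) (by positivity)
    _ = q * (Fintype.card ι * (‖toEuclideanCLM (𝕜 := ℝ) (D * Dᵀ)‖ *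
        ‖toEuclideanCLM (𝕜 := ℝ) (D * Dᵀ)⁻¹‖)) * ∑ a, z a ^ 2 := by ring
    _ ≤ _ := by gcongr

end LeastSquares

/-! ### From matrices to linear maps on state-input pairs. -/

section Identification

variable {n m T : ℕ}

/-- The coordinates of a state-input pair. -/
def coords (z : E n × E m) : Fin n ⊕ Fin m → ℝ := Sum.elim (fun j => z.1 j) fun j => z.2 j

theorem sum_sq_coords (z : E n × E m) : ∑ a, coords z a ^ 2 = ‖z.1‖ ^ 2 + ‖z.2‖ ^ 2 := by
  simp [coords, Fintype.sum_sum_type, EuclideanSpace.real_norm_sq_eq]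

/-- Pairs carry the maximum norm while least squares is Euclidean; this costs the factor `2` under
the root in `norm_stackedCLM_sub_le`. -/
theorem sum_sq_coords_le (z : E n × E m) : ∑ a, coords z a ^ 2 ≤ 2 * ‖z‖ ^ 2 := by
  rw [sum_sq_coords, two_mul]
  gcongr
  exacts [norm_fst_le z, norm_snd_le z]

theorem sq_norm_le_sum_sq_coords (z : E n × E m) : ‖z‖ ^ 2 ≤ ∑ a, coords z a ^ 2 := by
  rw [sum_sq_coords, Prod.norm_def]
  rcases max_cases ‖z.1‖ ‖z.2‖ with h | h <;> rw [h.1] <;>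
    nlinarith [sq_nonneg ‖z.1‖, sq_nonneg ‖z.2‖]

/-- State-input pairs as coordinate vectors. -/
def coordsEquiv (n m : ℕ) : (E n × E m) ≃ₗ[ℝ] (Fin n ⊕ Fin m → ℝ) :=
  ((WithLp.linearEquiv 2 ℝ (Fin n → ℝ)).prodCongr (WithLp.linearEquiv 2 ℝ (Fin m → ℝ))).trans
    (LinearEquiv.sumArrowLequivProdArrow (Fin n) (Fin m) ℝ ℝ).symm

theorem coordsEquiv_apply (z : E n × E m) : coordsEquiv n m z = coords z := by
  ext (j | j) <;> simp [coordsEquiv, coords]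

/-- The linear map `E n × E m → E n` with matrix `G = [A B]`. -/
def stackedCLM (G : Matrix (Fin n) (Fin n ⊕ Fin m) ℝ) : E n × E m →L[ℝ] E n :=
  LinearMap.toContinuousLinearMap ((WithLp.linearEquiv 2 ℝ (Fin n → ℝ)).symm.toLinearMap ∘ₗ
    Matrix.toLin' G ∘ₗ (coordsEquiv n m).toLinearMap)

theorem stackedCLM_apply (G : Matrix (Fin n) (Fin n ⊕ Fin m) ℝ) (z : E n × E m) (a : Fin n) :
    stackedCLM G z a = (G *ᵥ coords z) a := by
  simp [stackedCLM, ← coordsEquiv_apply]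

theorem exists_stackedCLM_eq (A : E n × E m →L[ℝ] E n) : ∃ F, stackedCLM F = A := by
  refine ⟨LinearMap.toMatrix' ((WithLp.linearEquiv 2 ℝ (Fin n → ℝ)).toLinearMap ∘ₗ
    A.toLinearMap ∘ₗ (coordsEquiv n m).symm.toLinearMap), ?_⟩
  refine ContinuousLinearMap.ext fun z => PiLp.ext fun a => ?_
  simp [stackedCLM]

theorem mem_lqrFeasible_iff {G : Fin T → Matrix (Fin n) (Fin n ⊕ Fin m) ℝ} {ζ : Curve n m T} :
    ζ ∈ OptimalControlProblem.lqrFeasible G ↔ IsLinearResponse (fun t => stackedCLM (G t)) ζ := by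
  refine and_congr_right fun _ => forall_congr' fun t => ?_
  rw [PiLp.ext_iff]
  refine forall_congr' fun a => ?_
  rw [stackedCLM_apply]
  rfl

/-- The estimate obtained from well-conditioned data is close to any linear map that fits the data
up to small relative residuals. -/
theorem norm_stackedCLM_sub_le {η : Curve n m T} {L : ℕ} {ηh : Fin L → Curve n m T} {t : Fin T}
    {M q : ℝ} (hM : conditionNumber (batch η ηh t * (batch η ηh t)ᵀ) ≤ ENNReal.ofReal M)
    {B : Matrix (Fin L) (Fin n ⊕ Fin m) ℝ} (hB : IsPseudoinverse (batch η ηh t) B)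
    (A : E n × E m →L[ℝ] E n) (hq : 0 ≤ q)
    (hres : ∀ i, ‖Curve.x (ηh i) t.succ - Curve.x η t.succ -
      A (Curve.xu (ηh i) t - Curve.xu η t)‖ ≤ q * ‖Curve.xu (ηh i) t - Curve.xu η t‖) :
    ‖stackedCLM (batchNext η ηh t * B) - A‖ ≤ √(2 * ((n + m : ℕ) * max M 0)) * q := by
  obtain ⟨F, rfl⟩ := exists_stackedCLM_eq A
  have hcol : ∀ i, (fun a => batch η ηh t a i) = coords (Curve.xu (ηh i) t - Curve.xu η t) := by
    intro i
    ext (a | a) <;> rfl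
  have hFD : ∀ a i, (F * batch η ηh t) a i =
      stackedCLM F (Curve.xu (ηh i) t - Curve.xu η t) a := by
    intro a i
    rw [stackedCLM_apply, ← hcol]
    rfl
  have herr := leastSquares_error hB hM F (batchNext η ηh t) (q := q ^ 2) (by positivity) (by
    intro i
    have h1 : ∑ a, (batchNext η ηh t a i - (F * batch η ηh t) a i) ^ 2 =
        ‖Curve.x (ηh i) t.succ - Curve.x η t.succ -
          stackedCLM F (Curve.xu (ηh i) t - Curve.xu η t)‖ ^ 2 := by
      rw [EuclideanSpace.real_norm_sq_eq]
      refine Finset.sum_congr rfl fun a _ => ?_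
      rw [hFD]
      rfl
    have h2 : ∑ a, batch η ηh t a i ^ 2 =
        ∑ a, coords (Curve.xu (ηh i) t - Curve.xu η t) a ^ 2 := by rw [← hcol]
    rw [h1, h2]
    calc _ ≤ (q * ‖Curve.xu (ηh i) t - Curve.xu η t‖) ^ 2 := by gcongr; exact hres i
      _ = q ^ 2 * ‖Curve.xu (ηh i) t - Curve.xu η t‖ ^ 2 := by ring
      _ ≤ _ := by gcongr; exact sq_norm_le_sum_sq_coords _)
  refine ContinuousLinearMap.opNorm_le_bound _ (by positivity) fun z => ?_
  refine abs_le_of_sq_le_sq' ?_ (by positivity) |>.2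
  have h3 : ‖(stackedCLM (batchNext η ηh t * B) - stackedCLM F) z‖ ^ 2 =
      ∑ a, ((batchNext η ηh t * B - F) *ᵥ coords z) a ^ 2 := by
    rw [EuclideanSpace.real_norm_sq_eq]
    refine Finset.sum_congr rfl fun a _ => ?_
    rw [Matrix.sub_mulVec, Pi.sub_apply, ← stackedCLM_apply, ← stackedCLM_apply]
    rfl
  rw [h3, mul_pow, mul_pow, Real.sq_sqrt (by positivity)]
  refine (herr (coords z)).trans ?_
  rw [Fintype.card_sum, Fintype.card_fin, Fintype.card_fin]
  calc _ ≤ q ^ 2 * (((n + m : ℕ) : ℝ) * max M 0) * (2 * ‖z‖ ^ 2) := by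
        gcongr; exact sum_sq_coords_le z
    _ = _ := by ring

end Identification

end DataDrivenPronto

end

noncomputable section

namespace DataDrivenPronto

open Metric Set Curve

variable {n m T : ℕ}

/-! ### Consequences of the Euler equation. -/

section Descent

variable {X : Type*} [NormedAddCommGroup X] [NormedSpace ℝ X]

theorem norm_le_div_of_mul_sq_le {ℓ : X →L[ℝ] ℝ} {ζ : X} {c C : ℝ} (hc : 0 < c) (hC : 0 ≤ C)
    (hℓ : ‖ℓ‖ ≤ C) (h : c * ‖ζ‖ ^ 2 ≤ -ℓ ζ) : ‖ζ‖ ≤ C / c := by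
  rw [le_div_iff₀' hc]
  have h1 : -ℓ ζ ≤ C * ‖ζ‖ := (neg_le_abs _).trans (ℓ.le_of_opNorm_le hℓ ζ)
  rcases (norm_nonneg ζ).eq_or_lt with h0 | h0
  · rw [← h0, mul_zero]; exact hC
  · exact le_of_mul_le_mul_right (by linarith [sq ‖ζ‖, mul_assoc c ‖ζ‖ ‖ζ‖]) h0

theorem apply_le_of_apply_eq {ψ ℓ : X →L[ℝ] ℝ} {ζ ζ' : X} {C C' e : ℝ} (h : ψ ζ' = ℓ ζ')
    (hψ : ‖ψ‖ ≤ C) (hℓ : ‖ℓ‖ ≤ C') (he : ‖ζ' - ζ‖ ≤ e) : ψ ζ ≤ ℓ ζ + (C + C') * e := by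
  have h3 : ψ ζ = ℓ ζ + (ℓ (ζ' - ζ) - ψ (ζ' - ζ)) := by
    rw [map_sub, map_sub, h]; ring
  have h4 := (le_abs_self _).trans (ℓ.le_of_opNorm_le_of_le hℓ he)
  have h5 := (neg_le_abs _).trans (ψ.le_of_opNorm_le_of_le hψ he)
  linarith

/-- The Euler equation holds only for directions `ξ` feasible for the identified system. Replacing
`ξ` by the nearby `w` adds an error of order `ε ‖w‖`. -/
theorem norm_apply_le_of_euler {B : X →L[ℝ] X →L[ℝ] ℝ} {ℓ : X →L[ℝ] ℝ} {ζ ξ w : X}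
    {C C' D ε : ℝ} (h : B ζ ξ + ℓ ξ = 0) (hB : ‖B‖ ≤ C) (hℓ : ‖ℓ‖ ≤ C') (hC : 0 ≤ C)
    (hC' : 0 ≤ C') (hD : 0 ≤ D) (hε : 0 ≤ ε) (hε1 : ε ≤ 1) (hξ : ‖ξ - w‖ ≤ D * ε * ‖w‖) :
    ‖ℓ w‖ ≤ (C * (1 + D) + C' * D) * (‖ζ‖ + ε) * ‖w‖ := by
  have h2 : ‖ξ‖ ≤ (1 + D) * ‖w‖ := by
    calc ‖ξ‖ = ‖w + (ξ - w)‖ := by rw [add_sub_cancel]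
      _ ≤ ‖w‖ + D * ε * ‖w‖ := (norm_add_le _ _).trans (by gcongr)
      _ ≤ ‖w‖ + D * 1 * ‖w‖ := by gcongr
      _ = _ := by ring
  have h3 : ℓ w = -(B ζ ξ) - ℓ (ξ - w) := by
    rw [map_sub]; linarith
  have h4 : ‖B ζ ξ‖ ≤ C * ‖ζ‖ * ((1 + D) * ‖w‖) :=
    (B ζ).le_of_opNorm_le_of_le (B.le_of_opNorm_le hB ζ) h2
  have h5 := ℓ.le_of_opNorm_le_of_le hℓ hξ
  have h6 : C * (1 + D) * ‖ζ‖ + C' * D * ε ≤ (C * (1 + D) + C' * D) * (‖ζ‖ + ε) := by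
    have : 0 ≤ C * (1 + D) * ε + C' * D * ‖ζ‖ := by positivity
    linarith
  rw [h3]
  refine (norm_sub_le _ _).trans ?_
  rw [norm_neg]
  calc _ ≤ (C * (1 + D) * ‖ζ‖ + C' * D * ε) * ‖w‖ := by linarith
    _ ≤ _ := by gcongr

end Descent

/-! ### Identification error, descent and isolation. -/

namespace OptimalControlProblem

variable {P : OptimalControlProblem n m T} {π : E n → E m → E n → ℕ → E m}

theorem xu_mem_closedBall {ηs η : Curve n m T} {r : ℝ} (hη : η ∈ closedBall ηs r) (t : Fin T) :
    xu η t ∈ closedBall (0 : E n × E m) (‖ηs‖ + r) := by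
  rw [mem_closedBall, dist_eq_norm] at hη
  rw [mem_closedBall, dist_zero_right]
  refine (norm_xu_le η t).trans ?_
  calc ‖η‖ = ‖ηs + (η - ηs)‖ := by rw [add_sub_cancel]
    _ ≤ _ := (norm_add_le _ _).trans (by linarith)

/-- The identified linearizations are accurate up to the size of the dithers. -/
theorem exists_identification_error [NeZero T] (hf : ContDiff ℝ 2 P.f)
    (hπ : ∀ t : ℕ, ContDiff ℝ 2 (fun p : E n × E m × E n => π p.1 p.2.1 p.2.2 t))
    (hπ_track : ∀ α μ t, π α μ α t = μ) (ηs : Curve n m T) (M r : ℝ) :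
    ∃ C > 0, ∃ δ₁ > 0, ∀ δx > 0, ∀ δu > 0, δx + δu ≤ δ₁ → ∀ η, P.IsTrajectory η →
      η ∈ closedBall ηs r → ∀ {L : ℕ} (dx : Fin L → Fin T → E n) (du : Fin L → Fin T → E m)
      (ηh : Fin L → Curve n m T), P.IsAdmissible π M δx δu η dx du ηh →
      ∀ t B, IsPseudoinverse (batch η ηh t) B →
      ‖stackedCLM (batchNext η ηh t * B) - fderiv ℝ P.f (xu η t)‖ ≤ C * (δx + δu) := by
  obtain ⟨C₁, hC₁, hlip⟩ := exists_norm_sub_le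
    ((contDiff_closedLoop hf hπ).of_le (by norm_num) : ContDiff ℝ 1 (P.closedLoop π))
    (P.xInit, states ηs, inputs ηs) r
  obtain ⟨C₂, hC₂, htay⟩ := exists_norm_sub_sub_fderiv_le hf 0 (‖ηs‖ + r)
  set κ := √(2 * ((n + m : ℕ) * max M 0)) with hκ
  have hκ0 : 0 ≤ κ := Real.sqrt_nonneg _
  refine ⟨(κ + 1) * (C₂ * C₁), by positivity, min 1 (1 / C₁), by positivity, ?_⟩
  intro δx hδx δu hδu hδ η hη hηr L dx du ηh hadm t B hB
  set δ := δx + δu with hδdef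
  have hδ0 : 0 < δ := by positivity
  have hδ1 : δ ≤ 1 := hδ.trans (min_le_left _ _)
  have hC₁δ : C₁ * δ ≤ 1 := by
    have : δ ≤ 1 / C₁ := hδ.trans (min_le_right _ _)
    rwa [le_div_iff₀' hC₁] at this
  have hexp : ∀ i, ‖ηh i - η‖ ≤ C₁ * δ := by
    intro i
    -- An experiment is the same smooth closed-loop map as `η`, evaluated at parameters shifted by
    -- the dithers.
    have h1 : ηh i = P.closedLoop π
        ((P.xInit, states η, inputs η) + (dx i 0, dx i, du i)) :=
      (hadm.2.1 i).eq_closedLoop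
    have h2 : η = P.closedLoop π (P.xInit, states η, inputs η) := (hη.proj_eq hπ_track).symm
    have hd : ‖(dx i 0, dx i, du i)‖ ≤ δ := by
      have hx : ∀ t, ‖dx i t‖ ≤ δ := fun t => by linarith [(hadm.1 i t).1]
      have hu : ∀ t, ‖du i t‖ ≤ δ := fun t => by linarith [(hadm.1 i t).2]
      exact max_le (hx 0) (max_le ((pi_norm_le_iff_of_nonneg hδ0.le).2 hx)
        ((pi_norm_le_iff_of_nonneg hδ0.le).2 hu))
    have hmem : (P.xInit, states η, inputs η) ∈
        closedBall (P.xInit, states ηs, inputs ηs) r := by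
      rw [mem_closedBall, dist_eq_norm] at hηr ⊢
      refine max_le ?_ (max_le ?_ ?_)
      · simpa using (norm_nonneg _).trans hηr
      · exact (norm_states_le (η - ηs)).trans hηr
      · exact (norm_inputs_le (η - ηs)).trans hηr
    have := hlip _ hmem _ (hd.trans hδ1)
    rw [← h1, ← h2] at this
    exact this.trans (mul_le_mul_of_nonneg_left hd hC₁.le)
  -- One factor of the quadratic Taylor remainder is bounded by `C₁ * δ`; the other is kept, which
  -- makes the residual a relative one.
  have key := norm_stackedCLM_sub_le (hadm.2.2 t) hB (fderiv ℝ P.f (xu η t))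
    (q := C₂ * (C₁ * δ)) (by positivity) (by
    intro i
    have hz : ‖xu (ηh i) t - xu η t‖ ≤ C₁ * δ := (norm_xu_le (ηh i - η) t).trans (hexp i)
    have hnext : x (ηh i) t.succ = P.f (xu (ηh i) t) := ((hadm.2.1 i).2 t).2
    have := htay _ (xu_mem_closedBall hηr t) (xu (ηh i) t - xu η t) (hz.trans hC₁δ)
    rw [add_sub_cancel] at this
    rw [hnext, hη.2 t]
    calc _ ≤ C₂ * ‖xu (ηh i) t - xu η t‖ ^ 2 := this
      _ = C₂ * ‖xu (ηh i) t - xu η t‖ * ‖xu (ηh i) t - xu η t‖ := by ring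
      _ ≤ C₂ * (C₁ * δ) * ‖xu (ηh i) t - xu η t‖ := by gcongr)
  refine key.trans ?_
  calc κ * (C₂ * (C₁ * δ)) ≤ (κ + 1) * (C₂ * (C₁ * δ)) := by gcongr; linarith
    _ = _ := by ring

/-- The decrease `c s²` is split: half absorbs the second-order term, a quarter absorbs the cross
term by Young's inequality, and the last quarter dominates `j²` up to `ε²`. -/
theorem descent_of_bounds {c C₃ C₄ C₆ γ s ε j d V V' : ℝ} (hc : 0 < c) (hC₄ : 0 < C₄)
    (hC₆ : 0 < C₆) (hγ : 0 < γ) (hγ' : γ ≤ c / (2 * C₄)) (hj : 0 ≤ j)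
    (hV : V' ≤ V + γ * d + C₄ * (γ * s) ^ 2) (hd : d ≤ -(c * s ^ 2) + C₃ * ε * s)
    (hjs : j ≤ C₆ * (s + ε)) :
    V' ≤ V - γ * (c / (8 * C₆ ^ 2) * j ^ 2) + γ * ((c / 4 + C₃ ^ 2 / c) * ε ^ 2) := by
  have h1 : C₄ * (γ * s) ^ 2 ≤ γ * (c / 2 * s ^ 2) := by
    rw [le_div_iff₀ (by positivity)] at hγ'
    have : C₄ * γ ≤ c / 2 := by linarith
    calc C₄ * (γ * s) ^ 2 = γ * (C₄ * γ * s ^ 2) := by ring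
      _ ≤ _ := by gcongr
  have h2 : C₃ * ε * s ≤ c / 4 * s ^ 2 + C₃ ^ 2 / c * ε ^ 2 := by
    have : c / 4 * s ^ 2 + C₃ ^ 2 / c * ε ^ 2 - C₃ * ε * s = c * (s / 2 - C₃ / c * ε) ^ 2 := by
      field_simp; ring
    have : 0 ≤ c * (s / 2 - C₃ / c * ε) ^ 2 := by positivity
    linarith
  have h3 : c / (8 * C₆ ^ 2) * j ^ 2 ≤ c / 4 * s ^ 2 + c / 4 * ε ^ 2 := by
    calc c / (8 * C₆ ^ 2) * j ^ 2 ≤ c / (8 * C₆ ^ 2) * (C₆ * (s + ε)) ^ 2 := by gcongr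
      _ = c / 8 * (s + ε) ^ 2 := by field_simp
      _ ≤ c / 8 * (2 * (s ^ 2 + ε ^ 2)) := by
        gcongr; nlinarith [sq_nonneg (s - ε)]
      _ = _ := by ring
  have h4 : γ * d ≤ γ * (-(c * s ^ 2) + (c / 4 * s ^ 2 + C₃ ^ 2 / c * ε ^ 2)) := by
    gcongr; linarith
  have h5 : γ * (c / (8 * C₆ ^ 2) * j ^ 2) ≤ γ * (c / 4 * s ^ 2 + c / 4 * ε ^ 2) := by
    gcongr
  linarith

/-- One iteration decreases the cost in proportion to the stepsize and the squared gradient of the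
reduced cost, up to a perturbation that is quadratic in the dither amplitudes. -/
theorem exists_descent [NeZero T] (hf : ContDiff ℝ 2 P.f) (hcost : ContDiff ℝ 2 P.cost)
    (hHess : ∀ ξ ζ : Curve n m T, ζ ≠ 0 → 0 < fderiv ℝ (fderiv ℝ P.cost) ξ ζ ζ)
    (hπ : ∀ t : ℕ, ContDiff ℝ 2 (fun p : E n × E m × E n => π p.1 p.2.1 p.2.2 t))
    (hπ_track : ∀ α μ t, π α μ α t = μ) (ηs : Curve n m T) (M r : ℝ) :
    ∃ κ > 0, ∃ C > 0, ∃ γ₁ > 0, ∃ δ₁ > 0, ∀ δx > 0, ∀ δu > 0, δx + δu ≤ δ₁ →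
      ∀ γ ∈ Ioc 0 γ₁, ∀ η, P.IsTrajectory η → η ∈ closedBall ηs r → ∀ η',
      P.IsStep π M δx δu γ η η' → P.IsTrajectory η' ∧ ‖η' - η‖ ≤ C * γ ∧
        P.cost η' ≤ P.cost η - γ * (κ * ‖fderiv ℝ P.reducedCost (inputs η)‖ ^ 2) +
          γ * (C * (δx + δu) ^ 2) := by
  have hf1 : ContDiff ℝ 1 P.f := hf.of_le (by norm_num)
  have hcost1 : ContDiff ℝ 1 P.cost := hcost.of_le (by norm_num)
  have hπ1 : ∀ t : ℕ, ContDiff ℝ 1 (fun p : E n × E m × E n => π p.1 p.2.1 p.2.2 t) :=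
    fun t => (hπ t).of_le (by norm_num)
  set Ψ : Curve n m T → ℝ := fun ξ => P.cost (P.proj π ξ) with hΨdef
  have hproj : ContDiff ℝ 2 (P.proj π) := contDiff_proj hf hπ
  have hΨ : ContDiff ℝ 2 Ψ := hcost.comp hproj
  have hH : Continuous (fderiv ℝ (fderiv ℝ P.cost)) :=
    (hcost.fderiv_right (m := 1) (by norm_num)).continuous_fderiv one_ne_zero
  obtain ⟨Cid, hCid, δ₁, hδ₁, hid⟩ := exists_identification_error hf hπ hπ_track ηs M r
  obtain ⟨c, hc, hcoer⟩ := exists_mul_sq_norm_le hH hHess ηs r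
  obtain ⟨CL, hCL, hCLb⟩ := exists_norm_le_closedBall
    (hcost1.continuous_fderiv one_ne_zero) ηs r
  obtain ⟨CH, hCH, hCHb⟩ := exists_norm_le_closedBall
    (Y := Curve n m T →L[ℝ] Curve n m T →L[ℝ] ℝ) hH ηs r
  obtain ⟨CΨ, hCΨ, hCΨb⟩ := exists_norm_le_closedBall
    ((hΨ.of_le (by norm_num) : ContDiff ℝ 1 Ψ).continuous_fderiv one_ne_zero) ηs r
  obtain ⟨C₄, hC₄, hC₄b⟩ := exists_norm_sub_sub_fderiv_le hΨ ηs r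
  obtain ⟨Cp, hCp, hCpb⟩ := exists_norm_sub_le
    (hproj.of_le (by norm_num) : ContDiff ℝ 1 (P.proj π)) ηs r
  obtain ⟨C₅, hC₅, hC₅b⟩ := exists_norm_le_closedBall
    (((contDiff_response hf1).continuous_fderiv one_ne_zero).comp
      (inputs : Curve n m T →L[ℝ] _).continuous) ηs r
  obtain ⟨a, ha, hab⟩ := exists_norm_le_closedBall (hf1.continuous_fderiv one_ne_zero) 0
    (‖ηs‖ + r)
  obtain ⟨C₂, hC₂, hcomp⟩ := exists_norm_sub_le_of_isLinearResponse n m T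
    (by positivity : 0 ≤ a + 1)
  set C₃ := (CΨ + CL) * C₂ with hC₃
  set C₆ := (CH * (1 + C₂) + CL * C₂) * C₅ with hC₆
  have hC₆0 : 0 < C₆ := by positivity
  refine ⟨c / (8 * C₆ ^ 2), by positivity,
    -- The first entry of the maximum bounds the step length, the second the perturbation. For the
    -- stepsize, `c / (2 * C₄)` absorbs the Taylor remainder, and `c / CL` gives `‖γ • ζ‖ ≤ 1`
    -- because `‖ζ‖ ≤ CL / c`.
    max (Cp * (CL / c)) ((c / 4 + C₃ ^ 2 / c) * Cid ^ 2), by positivity,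
    min (c / (2 * C₄)) (c / CL), by positivity, min δ₁ (1 / Cid), by positivity, ?_⟩
  rintro δx hδx δu hδu hδ γ ⟨hγ0, hγ⟩ η hη hηr η' ⟨L, -, dx, du, ηh, G, ζ, hadm, hG, hζf, hmin, hcl⟩
  set ε := Cid * (δx + δu) with hε
  have hε0 : 0 ≤ ε := by positivity
  have hε1 : ε ≤ 1 := by
    have : δx + δu ≤ 1 / Cid := hδ.trans (min_le_right _ _)
    rwa [le_div_iff₀' hCid] at this
  set A := fun t => fderiv ℝ P.f (xu η t) with hA
  set Â := fun t => stackedCLM (G t) with hÂ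
  have hAA : ∀ t, ‖Â t - A t‖ ≤ ε := by
    intro t
    obtain ⟨B, hB, hGB⟩ := hG t
    have := hid δx hδx δu hδu (hδ.trans (min_le_left _ _)) η hη hηr dx du ηh hadm t B hB
    simpa only [hÂ, hA, hGB] using this
  have hAa : ∀ t, ‖A t‖ ≤ a + 1 := fun t =>
    (hab _ (xu_mem_closedBall hηr t)).trans (by linarith)
  have hÂa : ∀ t, ‖Â t‖ ≤ a + 1 := fun t => by
    have := hab _ (xu_mem_closedBall hηr t)
    calc ‖Â t‖ = ‖A t + (Â t - A t)‖ := by rw [add_sub_cancel]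
      _ ≤ ‖A t‖ + ‖Â t - A t‖ := norm_add_le _ _
      _ ≤ a + 1 := add_le_add this ((hAA t).trans hε1)
  rw [mem_lqrFeasible_iff] at hζf
  -- the Euler equation of the descent problem
  have hEuler : ∀ w, IsLinearResponse Â w →
      fderiv ℝ (fderiv ℝ P.cost) η ζ w + fderiv ℝ P.cost η w = 0 := by
    intro w hw
    refine eq_zero_of_forall_quadratic_le (fun v w => ?_) fun s => ?_
    · exact (hcost.contDiffAt.isSymmSndFDerivAt (by simp)).eq v w
    · rw [← lqrCost_eq hcost, ← lqrCost_eq hcost]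
      exact hmin (mem_lqrFeasible_iff.2 (hζf.add_smul hw s))
  set s := ‖ζ‖ with hs
  have hs0 : 0 ≤ s := norm_nonneg ζ
  have hcs : c * s ^ 2 ≤ -fderiv ℝ P.cost η ζ := by
    have h1 := hcoer η hηr ζ
    have h2 := hEuler ζ hζf
    linarith
  have hsle : s ≤ CL / c := norm_le_div_of_mul_sq_le hc hCL.le (hCLb η hηr) hcs
  have hγs : ‖γ • ζ‖ = γ * s := by rw [norm_smul, Real.norm_of_nonneg hγ0.le]
  have hγs1 : γ * s ≤ 1 := by
    have : γ ≤ c / CL := hγ.trans (min_le_right _ _)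
    calc γ * s ≤ c / CL * (CL / c) := by gcongr
      _ = 1 := by field_simp
  have hη' : η' = P.proj π (η + γ • ζ) := hcl.eq_closedLoop
  -- comparison with the exact linearization
  have hd : fderiv ℝ Ψ η ζ ≤ -(c * s ^ 2) + C₃ * ε * s := by
    -- The direction `ζ` need not be tangent, so the derivatives of `Ψ` and the cost are compared at
    -- the true response `ζv` to the same inputs.
    obtain ⟨ζv, hζv, hinp⟩ := exists_isLinearResponse A (inputs ζ)
    have htan : P.IsTangent η ζv := hζv
    have h1 : ‖ζv - ζ‖ ≤ C₂ * ε * s := hcomp ε hε0 A Â hAa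
      (fun t => by rw [norm_sub_rev]; exact hAA t) ζv ζ hζv hζf hinp
    have h2 := fderiv_cost_proj hf1 hcost1 hπ1 hπ_track hη htan
    have h3 := apply_le_of_apply_eq h2 (hCΨb η hηr) (hCLb η hηr) h1
    rw [hC₃]
    linarith
  -- the descent direction controls the gradient of the reduced cost
  have hj : ‖fderiv ℝ P.reducedCost (inputs η)‖ ≤ C₆ * (s + ε) := by
    refine ContinuousLinearMap.opNorm_le_bound _ (by positivity) fun w => ?_
    rw [fderiv_reducedCost hf1 hcost1 hη]
    set ζw := fderiv ℝ P.response (inputs η) w with hζw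
    have htan : IsLinearResponse A ζw := by
      have := isTangent_fderiv_response hf1 (inputs η) w
      rwa [hη.response_inputs] at this
    have hζwn : ‖ζw‖ ≤ C₅ * ‖w‖ := ContinuousLinearMap.le_of_opNorm_le _ (hC₅b η hηr) w
    -- The identified response to the input `w` is an admissible test direction in the Euler
    -- equation and is close to the tangent vector `ζw`.
    obtain ⟨ξ, hξ, hinp⟩ := exists_isLinearResponse Â w
    have h1 : ‖ξ - ζw‖ ≤ C₂ * ε * ‖ζw‖ := hcomp ε hε0 Â A hÂa hAA ξ ζw hξ htan
      (hinp.trans (inputs_fderiv_response hf1 _ _).symm)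
    refine (norm_apply_le_of_euler (hEuler ξ hξ) (hCHb η hηr) (hCLb η hηr) hCH.le hCL.le hC₂.le
      hε0 hε1 h1).trans ?_
    calc _ ≤ (CH * (1 + C₂) + CL * C₂) * (‖ζ‖ + ε) * (C₅ * ‖w‖) := by gcongr
      _ = _ := by rw [hC₆]; ring
  refine ⟨hcl.isTrajectory, ?_, ?_⟩
  · have h1 := hCpb η hηr (γ • ζ) (hγs.trans_le hγs1)
    rw [← hη', hη.proj_eq hπ_track, hγs] at h1
    calc ‖η' - η‖ ≤ Cp * (γ * s) := h1
      _ ≤ Cp * (γ * (CL / c)) := by gcongr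
      _ = Cp * (CL / c) * γ := by ring
      _ ≤ _ := by gcongr; exact le_max_left _ _
  · have h1 := hC₄b η hηr (γ • ζ) (hγs.trans_le hγs1)
    have hΨη' : Ψ (η + γ • ζ) = P.cost η' := by rw [hη']
    have hΨη : Ψ η = P.cost η := by simp only [hΨdef, hη.proj_eq hπ_track]
    rw [hΨη', hΨη, hγs, map_smul, smul_eq_mul] at h1
    have hV : P.cost η' ≤ P.cost η + γ * fderiv ℝ Ψ η ζ + C₄ * (γ * s) ^ 2 := by
      linarith [le_abs_self (P.cost η' - P.cost η - γ * fderiv ℝ Ψ η ζ), Real.norm_eq_abs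
        (P.cost η' - P.cost η - γ * fderiv ℝ Ψ η ζ)]
    refine (descent_of_bounds hc hC₄ hC₆0 hγ0 (hγ.trans (min_le_left _ _)) (norm_nonneg _)
      hV hd hj).trans ?_
    have : (c / 4 + C₃ ^ 2 / c) * ε ^ 2 ≤
        max (Cp * (CL / c)) ((c / 4 + C₃ ^ 2 / c) * Cid ^ 2) * (δx + δu) ^ 2 := by
      have hsq : (c / 4 + C₃ ^ 2 / c) * ε ^ 2 =
          (c / 4 + C₃ ^ 2 / c) * Cid ^ 2 * (δx + δu) ^ 2 := by rw [hε]; ring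
      rw [hsq]
      gcongr
      exact le_max_right _ _
    gcongr

/-- Near an isolated local minimum, the other trajectories have a larger cost and are not critical
for the reduced cost. -/
theorem IsIsolatedLocalMin.exists_pos (hf : ContDiff ℝ 1 P.f) (hcost : ContDiff ℝ 1 P.cost)
    {ηs : Curve n m T} (h : P.IsIsolatedLocalMin ηs) :
    ∃ r > 0, ∀ η, P.IsTrajectory η → η ∈ closedBall ηs r → η ≠ ηs →
      P.cost ηs < P.cost η ∧ fderiv ℝ P.reducedCost (inputs η) ≠ 0 := by
  obtain ⟨-, r, hr, hmin⟩ := h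
  refine ⟨r / 2, half_pos hr, fun η hη hηr hne => ?_⟩
  have hball : η ∈ ball ηs r := closedBall_subset_ball (half_lt_self hr) hηr
  have hD : fderiv ℝ P.reducedCost (inputs η) ≠ 0 := fun h0 =>
    hne ((hmin η hball hη).2 ((isStationary_iff hf hcost hη).2 h0))
  -- Equal cost would make `η` a local minimum among trajectories too, hence critical for the
  -- reduced cost, against isolation.
  refine ⟨lt_of_le_of_ne (hmin η hball hη).1 fun heq => hD ?_, hD⟩
  refine IsLocalMin.fderiv_eq_zero ?_
  have hcont : Filter.Tendsto P.response (nhds (inputs η)) (nhds η) := by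
    have := (contDiff_response hf).continuous.tendsto (inputs η)
    rwa [hη.response_inputs] at this
  filter_upwards [hcont (isOpen_ball.mem_nhds hball)] with v hv
  rw [reducedCost, reducedCost, hη.response_inputs, ← heq]
  exact (hmin _ hv (isTrajectory_response v)).1

end OptimalControlProblem

/-- The added linear term upgrades monotone to strictly increasing in each amplitude. -/
theorem isUltimateBound_add {β : ℝ → ℝ} (hβ : MonotoneOn β (Ici 0)) (hβ0 : β 0 = 0) :
    IsUltimateBound fun δx δu => β (δx + δu) + (δx + δu) := by
  refine ⟨by simp [hβ0], fun δu hδu a ha b hb hab => ?_, fun δx hδx a ha b hb hab => ?_⟩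
  · exact add_lt_add_of_le_of_lt
      (hβ (add_nonneg ha hδu) (add_nonneg hb hδu) (by linarith)) (by linarith)
  · exact add_lt_add_of_le_of_lt
      (hβ (add_nonneg hδx ha) (add_nonneg hδx hb) (by linarith)) (by linarith)

end DataDrivenPronto

end

/-! ### Assembly of the theorem. -/

theorem theorem1 {n m T : ℕ} [NeZero T]
    (P : DataDrivenPronto.OptimalControlProblem n m T)
    (π : DataDrivenPronto.E n → DataDrivenPronto.E m → DataDrivenPronto.E n → ℕ →
      DataDrivenPronto.E m)
    (hf : ContDiff ℝ 2 P.f)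
    (hcost : ContDiff ℝ 2 P.cost)
    (hHess : ∀ ξ ζ : DataDrivenPronto.Curve n m T, ζ ≠ 0 →
      0 < fderiv ℝ (fderiv ℝ P.cost) ξ ζ ζ)
    (hπ : ∀ t : ℕ, ContDiff ℝ 2
      (fun p : DataDrivenPronto.E n × DataDrivenPronto.E m × DataDrivenPronto.E n =>
        π p.1 p.2.1 p.2.2 t))
    (hπ_track : ∀ α μ t, π α μ α t = μ)
    (ηs : DataDrivenPronto.Curve n m T) (hηs : P.IsIsolatedLocalMin ηs)
    (M : ℝ) (hM : 0 < M) (hwp : P.WellPosed π M ηs) :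
    ∃ γs > 0, ∃ δbx > 0, ∃ δbu > 0, ∃ ρ > 0,
      (∃ (N : ℕ) (b : ℝ → ℝ → ℝ), DataDrivenPronto.IsUltimateBound b ∧
        ∀ δx ∈ Set.Ioo 0 δbx, ∀ δu ∈ Set.Ioo 0 δbu, ∀ γ ∈ Set.Ioc 0 γs,
          ∀ η : ℕ → DataDrivenPronto.Curve n m T, P.IsRun π M δx δu γ η →
            η 0 ∈ Metric.ball ηs ρ → ∀ k ≥ N, ‖η k - ηs‖ ≤ b δx δu) ∧
      (∃ b : ℝ → ℝ → ℝ, DataDrivenPronto.IsUltimateBound b ∧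
        ContinuousOn (Function.uncurry b) (Set.Ici 0 ×ˢ Set.Ici 0) ∧
        ∀ δx ∈ Set.Ioo 0 δbx, ∀ δu ∈ Set.Ioo 0 δbu, ∀ γ ∈ Set.Ioc 0 γs, ∃ N : ℕ,
          ∀ η : ℕ → DataDrivenPronto.Curve n m T, P.IsRun π M δx δu γ η →
            η 0 ∈ Metric.ball ηs ρ → ∀ k ≥ N, ‖η k - ηs‖ ≤ b δx δu) := by
  have hf1 : ContDiff ℝ 1 P.f := hf.of_le (by norm_num)
  have hcost1 : ContDiff ℝ 1 P.cost := hcost.of_le (by norm_num)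
  obtain ⟨r, hr, hpos⟩ := hηs.exists_pos hf1 hcost1
  obtain ⟨κ, hκ, C, hC, γ₁, hγ₁, δ₁, hδ₁, hdesc⟩ :=
    DataDrivenPronto.OptimalControlProblem.exists_descent hf hcost hHess hπ hπ_track ηs M r
  obtain ⟨γs, hγs, δb, hδb, ρ, hρ, hbdd, hult⟩ := DataDrivenPronto.practical_stability
    (S := {η | P.IsTrajectory η}) (z := ηs) (V := fun η => P.cost η - P.cost ηs)
    (W := fun η => κ * ‖fderiv ℝ P.reducedCost (DataDrivenPronto.Curve.inputs η)‖ ^ 2)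
    (Step := fun δx δu γ => P.IsStep π M δx δu γ) (C := C) (γ₁ := γ₁) (δ₁ := δ₁) (r := r)
    (DataDrivenPronto.OptimalControlProblem.isClosed_isTrajectory hf.continuous)
    (hcost.continuous.sub continuous_const)
    (continuous_const.mul ((((DataDrivenPronto.OptimalControlProblem.contDiff_reducedCost hf1
      hcost1).continuous_fderiv one_ne_zero).comp DataDrivenPronto.Curve.inputs.continuous).norm.pow 2))
    (sub_self _) (fun η => by positivity) hr
    (fun η hη hηr hne => by
      obtain ⟨h1, h2⟩ := hpos η hη hηr hne
      have := norm_pos_iff.2 h2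
      exact ⟨sub_pos.2 h1, by positivity⟩)
    hC hγ₁ hδ₁
    (fun δx hδx δu hδu hδ γ hγ η hη hηr η' hst => by
      obtain ⟨h1, h2, h3⟩ := hdesc δx hδx δu hδu hδ γ hγ η hη hηr η' hst
      exact ⟨h1, h2, by linarith⟩)
  refine ⟨γs, hγs, δb / 2, by positivity, δb / 2, by positivity, ρ, hρ, ?_, ?_⟩
  -- The bound jumps to `r` as soon as the amplitudes are positive, so invariance of the ball of
  -- radius `r` suffices from the first iterate on.
  · refine ⟨0, _, DataDrivenPronto.isUltimateBound_add (β := fun δ => if 0 < δ then r else 0)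
      (fun a _ b _ hab => ?_) (by simp), ?_⟩
    · dsimp only
      split_ifs with h1 h2
      exacts [le_rfl, absurd (h1.trans_le hab) h2, hr.le, le_rfl]
    · intro δx hδx δu hδu γ hγ η hrun hball k _
      have hδ : 0 < δx + δu := add_pos hδx.1 hδu.1
      have := hbdd δx hδx.1 δu hδu.1 (by linarith [hδx.2, hδu.2]) γ hγ η hrun.1 hrun.2 hball k
      simp only [if_pos hδ]
      linarith
  · choose D hD hDult using fun k : ℕ => hult (r * (1 / 2) ^ (k + 1)) (by positivity)
    obtain ⟨β, hβc, hβm, hβ0, hβ⟩ := DataDrivenPronto.exists_comparison_function hr.le hD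
    refine ⟨_, DataDrivenPronto.isUltimateBound_add hβm hβ0, ?_, ?_⟩
    · refine Continuous.continuousOn ?_
      have : Continuous fun p : ℝ × ℝ => β (p.1 + p.2) + (p.1 + p.2) := by fun_prop
      exact this
    · intro δx hδx δu hδu γ hγ
      have hδ : 0 < δx + δu := add_pos hδx.1 hδu.1
      have hδb' : δx + δu ≤ δb := by linarith [hδx.2, hδu.2]
      -- Either `β` already exceeds the invariant radius `r`, or the amplitude is below the
      -- threshold `D k` whose guaranteed radius lies under `β`.
      rcases hβ (δx + δu) hδ with h | ⟨k, hk, h⟩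
      · refine ⟨0, fun η hrun hball k _ => ?_⟩
        have := hbdd δx hδx.1 δu hδu.1 hδb' γ hγ η hrun.1 hrun.2 hball k
        linarith
      · obtain ⟨N, hN⟩ := hDult k δx hδx.1 δu hδu.1 hδb' hk γ hγ
        refine ⟨N, fun η hrun hball j hj => ?_⟩
        have := hN η hrun.1 hrun.2 hball j hj
        linarith
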